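/- **Setting.** Let $\rho_0$ be a density operator on $n$ qubits (pure or mixed), let $U(x,\theta)$ be an $n$-qubit unitary depending on an input $x$ and a parameter $\theta$, put $\rho_{x,\theta}=U(x,\theta)\rho_0U(x,\theta)^\dagger$, and let $$k_Q(x,x')=\mathrm{Tr}[\rho_{x,\theta}\,\rho_{x',\theta}]$$ be the fidelity-based quantum kernel. The data $x,x',\theta$ are drawn at random (each of them may also be fixed) in such a way that the unitaries $U(x,\theta)$ and $U(x',\theta)$ are measurable and independent; this includes the case in which $U(x',\theta)$ is held fixed. A random unitary $W$ is a $t$-design if $\mathbb E[W^{\otimes t}R\,(W^\dagger)^{\otimes t}]=\int W^{\otimes t}R\,(W^\dagger)^{\otimes t}\,d\mu(W)$ for every operator $R$, where $\mu$ is the Haar probability measure on the unitary group. **(1) Circuit acting on all $n$ qubits.** Suppose that $U(x,\theta)$ or $U(x',\theta)$ is a $t$-design on all $n$ qubits. If $t\ge1$, then $\mathbb E[k_Q]=\frac1{2^n}$. If $t\ge 2$ and $\rho_0$ is pure, then $$\mathrm{Var}[k_Q]=\frac{2^n-1}{2^{2n}(2^n+1)}.$$ If $t\ge2$ and $\rho_0$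 is an arbitrary, possibly mixed, density operator, then the right-hand side is an upper bound for $\mathrm{Var}[k_Q]$. In particular, for $t\ge 2$, $k_Q$ concentrates exponentially in $n$: $\mathrm{Var}[k_Q]\le 4^{-n}$, and $\Pr[|k_Q-2^{-n}|\ge\delta]\le 4^{-n}/\delta^2$ for every $\delta>0$. **(2) Alternating layered ansatz.** Let $n=m\kappa$ with $m,\kappa\ge1$ and let $U=V_L\cdots V_1$ with $L\ge1$, where each layer $V_d=\prod_{k=1}^{\kappa}W_{k,d}$ consists of $\kappa$ blocks acting on disjoint sets of $m$ qubits. The arrangement of the qubits into blocks may be chosen arbitrarily in each layer; in the alternating layered ansatz the blocks are runs of $m$ consecutive qubits of the cyclically ordered register, shifted by $\lfloor m/2\rfloor$ qubits in every other layer. Suppose that the blocks $W_{k,d}(x,\theta)$ are mutually independent $t$-designs on $m$ qubits, jointly independent of $U(x',\theta)$. If $t\ge1$, then $\mathbb E[k_Q]=\frac1{2^n}$. If $t\ge2$, then, whether $\rho_0$ is pure or mixed, $$\mathrm{Var}[k_Q]\le B(m,\kappa):=\frac{2^\kappa}{(2^{2m}-1)^\kappa}-\frac1{2^{2n}} .$$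 In particular, for $t\ge2$, $k_Q$ concentrates exponentially in $n$: $\mathrm{Var}[k_Q]\le (2/3)^n$, and $\Pr[|k_Q-2^{-n}|\ge\delta]\le (2/3)^n/\delta^2$ for every $\delta>0$. The bound is about $2^{-n(2-1/m)}$ in the following sense. For all $m,\kappa\ge1$, with $n=m\kappa$, $$B(m,\kappa)=\bigl((1-4^{-m})^{-\kappa}-2^{-\kappa}\bigr)\,2^{-n(2-1/m)},$$ and hence $B(m,\kappa)/2^{-n(2-1/m)}\to1$ along all sequences of $(m,\kappa)$ with $\kappa\to\infty$ and $\kappa\,4^{-m}\to0$. -/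

import Mathlib

open MeasureTheory ProbabilityTheory Filter Topology
open scoped ComplexOrder

namespace QKernel

/-- Computational basis labels (bit strings) of a register of `n` qubits. -/
abbrev Bits (n : ℕ) : Type := Fin n → Fin 2

/-- The unitary group of the Hilbert space with orthonormal basis `ι`. -/
abbrev UGroup (ι : Type) [Fintype ι] [DecidableEq ι] : Type := Matrix.unitaryGroup ι ℂ

section Haar

variable (ι : Type) [Fintype ι] [DecidableEq ι]

/-- The Borel `σ`-algebra on the unitary group. -/
noncomputable instance instMeasurableSpaceUGroup : MeasurableSpace (UGroup ι) := borel _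

instance instBorelSpaceUGroup : BorelSpace (UGroup ι) := ⟨rfl⟩

instance instCompactSpaceUGroup : CompactSpace (UGroup ι) := by
  have hclosed : IsClosed (Matrix.unitaryGroup ι ℂ : Set (Matrix ι ι ℂ)) := isClosed_unitary
  have hK : IsCompact (Set.univ.pi fun _ : ι => Set.univ.pi fun _ : ι =>
      Metric.closedBall (0 : ℂ) 1) :=
    isCompact_univ_pi fun _ => isCompact_univ_pi fun _ => isCompact_closedBall 0 1
  have hsub : (Matrix.unitaryGroup ι ℂ : Set (Matrix ι ι ℂ)) ⊆
      (Set.univ.pi fun _ : ι => Set.univ.pi fun _ : ι => Metric.closedBall (0 : ℂ) 1) := by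
    intro U hU i _ j _
    simpa using entry_norm_bound_of_unitary hU i j
  exact isCompact_iff_compactSpace.mp (hK.of_isClosed_subset hclosed hsub)

/-- The Haar probability measure of the unitary group. -/
noncomputable def haarUnitary : Measure (UGroup ι) := Measure.haarMeasure ⊤

end Haar

section Design

variable {ι : Type} [Fintype ι] [DecidableEq ι]

/-- The matrix of `A ⊗ ⋯ ⊗ A` (`t` factors) in the product basis. -/
def tensorPow (t : ℕ) (A : Matrix ι ι ℂ) : Matrix (Fin t → ι) (Fin t → ι) ℂ :=
  Matrix.of fun i j => ∏ s, A (i s) (j s)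

/-- The random unitary `W` on `(Ω, P)` is a `t`-design: for every operator `R` on the `t`-fold
tensor power, `𝔼[W^{⊗t} R (W†)^{⊗t}] = ∫ W^{⊗t} R (W†)^{⊗t} dμ(W)` with `μ` the Haar measure
(an equality of matrices, both sides being integrated entrywise). A finite or countable ensemble
`{p_i, W_i}` is the case in which `Ω` is its index set and `P {i} = p_i`. -/
def IsTDesign {Ω : Type*} [MeasurableSpace Ω] (P : Measure Ω) (t : ℕ) (W : Ω → UGroup ι) : Prop :=
  ∀ (R : Matrix (Fin t → ι) (Fin t → ι) ℂ) (i j : Fin t → ι),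
    ∫ ω, (tensorPow t (W ω : Matrix ι ι ℂ) * R *
        tensorPow t (W ω : Matrix ι ι ℂ).conjTranspose) i j ∂P =
      ∫ V, (tensorPow t (V : Matrix ι ι ℂ) * R *
        tensorPow t (V : Matrix ι ι ℂ).conjTranspose) i j ∂(haarUnitary ι)

/-- Density operators. -/
def IsDensity (ρ : Matrix ι ι ℂ) : Prop := ρ.PosSemidef ∧ ρ.trace = 1

/-- Pure states `|ψ⟩⟨ψ|` with `⟨ψ|ψ⟩ = 1`. -/
def IsPure (ρ : Matrix ι ι ℂ) : Prop :=
  ∃ ψ : ι → ℂ, star ψ ⬝ᵥ ψ = 1 ∧ ρ = Matrix.vecMulVec ψ (star ψ)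

end Design

section Kernel

variable {ι : Type} [Fintype ι] [DecidableEq ι] {X Θ : Type*}

/-- `ρ_{x,θ} = U(x,θ) ρ₀ U(x,θ)†`. -/
def encodedState (U : X → Θ → UGroup ι) (ρ₀ : Matrix ι ι ℂ) (x : X) (θ : Θ) : Matrix ι ι ℂ :=
  (U x θ : Matrix ι ι ℂ) * ρ₀ * (U x θ : Matrix ι ι ℂ).conjTranspose

/-- The fidelity-based quantum kernel `k_Q(x,x') = Tr[ρ_{x,θ} ρ_{x',θ}]`. The trace is a real
number when `ρ₀` is Hermitian, see `quantumKernel_eq_trace`. -/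
noncomputable def quantumKernel (U : X → Θ → UGroup ι) (ρ₀ : Matrix ι ι ℂ) (θ : Θ) (x x' : X) : ℝ :=
  (Matrix.trace (encodedState U ρ₀ x θ * encodedState U ρ₀ x' θ)).re

theorem quantumKernel_eq_trace (U : X → Θ → UGroup ι) {ρ₀ : Matrix ι ι ℂ} (h : ρ₀.IsHermitian)
    (θ : Θ) (x x' : X) :
    (quantumKernel U ρ₀ θ x x' : ℂ) =
      Matrix.trace (encodedState U ρ₀ x θ * encodedState U ρ₀ x' θ) := by
  have hE : ∀ y, (encodedState U ρ₀ y θ).conjTranspose = encodedState U ρ₀ y θ := by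
    intro y
    simp only [encodedState, Matrix.conjTranspose_mul, Matrix.conjTranspose_conjTranspose, h.eq,
      Matrix.mul_assoc]
  apply Complex.conj_eq_iff_re.mp
  rw [starRingEnd_apply, ← Matrix.trace_conjTranspose, Matrix.conjTranspose_mul, hE, hE,
    Matrix.trace_mul_comm]

end Kernel

section Layers

variable {n m κ L : ℕ}

/-- One layer of `κ` blocks of `m` qubits each. The bijection `e` says which qubits a block acts
on: block `k` acts on the qubits `e (k, 0), …, e (k, m - 1)`. The layer is the tensor product of its
blocks (the product of the commuting operators `W_k ⊗ 𝕀`). -/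
def layerMatrix (e : Fin κ × Fin m ≃ Fin n) (W : Fin κ → UGroup (Bits m)) :
    Matrix (Bits n) (Bits n) ℂ :=
  Matrix.of fun i j =>
    ∏ k, (W k : Matrix (Bits m) (Bits m) ℂ) (fun q => i (e (k, q))) (fun q => j (e (k, q)))

theorem layerMatrix_mem (e : Fin κ × Fin m ≃ Fin n) (W : Fin κ → UGroup (Bits m)) :
    layerMatrix e W ∈ Matrix.unitaryGroup (Bits n) ℂ := by
  rw [Matrix.mem_unitaryGroup_iff']
  let f : Bits n ≃ (Fin κ → Bits m) :=
    (e.symm.arrowCongr (Equiv.refl (Fin 2))).trans (Equiv.curry _ _ _)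
  have hf : ∀ (i : Bits n) k, f i k = fun q => i (e (k, q)) := fun i k => rfl
  ext i l
  have hW : ∀ k, ∑ b : Bits m, star ((W k : Matrix (Bits m) (Bits m) ℂ) b (f i k)) *
      (W k : Matrix (Bits m) (Bits m) ℂ) b (f l k) = if f i k = f l k then 1 else 0 := by
    intro k
    have h := Matrix.mem_unitaryGroup_iff'.mp (W k).2
    have h2 := congrFun (congrFun h (f i k)) (f l k)
    simpa [Matrix.mul_apply, Matrix.star_apply, Matrix.one_apply] using h2
  calc (star (layerMatrix e W) * layerMatrix e W) i l
      = ∑ j : Bits n, ∏ k, (star ((W k : Matrix (Bits m) (Bits m) ℂ) (f j k) (f i k)) *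
          (W k : Matrix (Bits m) (Bits m) ℂ) (f j k) (f l k)) := by
        simp [Matrix.mul_apply, Matrix.star_apply, layerMatrix, hf, Finset.prod_mul_distrib]
    _ = ∑ g : Fin κ → Bits m, ∏ k, (star ((W k : Matrix (Bits m) (Bits m) ℂ) (g k) (f i k)) *
          (W k : Matrix (Bits m) (Bits m) ℂ) (g k) (f l k)) :=
        f.sum_comp (fun g => ∏ k, (star ((W k : Matrix (Bits m) (Bits m) ℂ) (g k) (f i k)) *
          (W k : Matrix (Bits m) (Bits m) ℂ) (g k) (f l k)))
    _ = ∏ k, (if f i k = f l k then (1 : ℂ) else 0) := by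
        rw [← Fintype.prod_sum (fun k b => star ((W k : Matrix (Bits m) (Bits m) ℂ) b (f i k)) *
          (W k : Matrix (Bits m) (Bits m) ℂ) b (f l k))]
        exact Finset.prod_congr rfl fun k _ => hW k
    _ = (1 : Matrix (Bits n) (Bits n) ℂ) i l := by
        by_cases h : i = l
        · subst h
          simp
        · have h2 : f i ≠ f l := fun h3 => h (f.injective h3)
          obtain ⟨k, hk⟩ := Function.ne_iff.mp h2
          rw [Matrix.one_apply_ne h]
          exact Finset.prod_eq_zero (Finset.mem_univ k) (by simp [hk])

/-- The layer as an element of the unitary group. -/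
def layer (e : Fin κ × Fin m ≃ Fin n) (W : Fin κ → UGroup (Bits m)) : UGroup (Bits n) :=
  ⟨layerMatrix e W, layerMatrix_mem e W⟩

/-- The layered circuit `V_L ⋯ V_2 V_1`, whose `d`-th layer `V_d` consists of the blocks
`W d 0, …, W d (κ - 1)` placed on the qubits according to `layout d`. -/
def layeredCircuit (layout : Fin L → (Fin κ × Fin m ≃ Fin n))
    (W : Fin L → Fin κ → UGroup (Bits m)) : UGroup (Bits n) :=
  ((List.ofFn fun d => layer (layout d) (W d)).reverse).prod

/-- The layout of the alternating layered ansatz on `n = m κ` qubits: every layer cuts the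
(cyclically ordered) qubits into `κ` runs of `m` consecutive qubits, and in every other layer the
cuts are shifted by `m / 2` qubits, so that a block shares `m / 2` qubits with each of two
neighbouring blocks of the previous layer. For `m = 1` there is no shift, and the circuit is a
tensor-product circuit. -/
def alternatingLayout (hn : n = m * κ) (d : Fin L) : Fin κ × Fin m ≃ Fin n :=
  (finProdFinEquiv.trans (finCongr ((Nat.mul_comm κ m).trans hn.symm))).trans
    (if d.val % 2 = 0 then Equiv.refl _ else (finRotate n ^ (m / 2) : Equiv.Perm (Fin n)))

end Layers

end QKernel

/-!
Everything reduces to moments of the overlap `Tr[V ρ V† σ]` of fixed states under a random unitary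
`V`: by independence, the other unitary and, in a layered circuit, all layers but the last may be
fixed first (`integral_indep_eq`, `integral_indep_le`), since they only change `ρ` and `σ` into
other density operators. Variance and tail bounds then follow from the first two moments of the
kernel and Chebyshev's inequality.

The moments of degree at most two in `V` and two in its conjugate are those of the Haar measure,
given for dimension `d ≥ 2` by the Weingarten formula `entryMoment_haar`. Its proof uses only the
two-sided invariance of the Haar measure. Phases of rows and columns kill all moments but five
kinds, permutations make each kind constant, and these constants are determined by the
normalization of rows and columns, the orthogonality of two rows, and one reflection mixing two
columns, which gives `𝔼|V_{ab}|⁴ = 2 𝔼|V_{ab}|²|V_{ab'}|²`.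

Writing `ρ = ∑ |ψ_i⟩⟨ψ_i|` and `σ = ∑ |φ_j⟩⟨φ_j|`, the overlap is the sum of the squared moduli of
the linear forms `⟨φ_j|V|ψ_i⟩` in the entries of `V` (`overlap_sum_vecMulVec`). For one such form,
`𝔼|⟨φ|V|ψ⟩|⁴ = 2 / (d (d + 1)) ‖φ‖⁴ ‖ψ‖⁴`, and Minkowski's inequality in `L²` (`integral_sum_sq_le`)
shows that mixed states have at most the second moment of pure states.

For a layer of `κ` independent blocks, the amplitudes are multilinear forms in the blocks. Every
linear form in the entries of a single block satisfies
`𝔼|∑ v_{ab} V_{ab}|⁴ ≤ 2 / (D² - 1) (∑ |v_{ab}|²)²` with `D = 2 ^ m`, because the negative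
Weingarten terms add up to minus a sum of squares. Such bounds multiply when the blocks are
integrated out one at a time, again by Minkowski's inequality
(`integral_pi_sum_norm_tensorForm_le`), so the second moment of the overlap is at most
`(2 / (D² - 1)) ^ κ`, for all states, entangled or mixed.
-/

namespace QKernel

/-! ### The unitary group as a compact probability space -/

section Topology

variable (ι : Type) [Fintype ι] [DecidableEq ι]

instance instSecondCountableTopologyUGroup : SecondCountableTopology (UGroup ι) :=
  have : SecondCountableTopology (Matrix ι ι ℂ) :=
    inferInstanceAs (SecondCountableTopology (ι → ι → ℂ))
  TopologicalSpace.Subtype.secondCountableTopology _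

instance instIsProbabilityMeasureHaarUnitary : IsProbabilityMeasure (haarUnitary ι) :=
  ⟨by simpa [haarUnitary] using
    Measure.haarMeasure_self (K₀ := (⊤ : TopologicalSpace.PositiveCompacts (UGroup ι)))⟩

instance instIsHaarMeasureHaarUnitary : (haarUnitary ι).IsHaarMeasure :=
  Measure.isHaarMeasure_haarMeasure _

/-- Right translates of the Haar measure are left-invariant probability measures, hence equal to
it. -/
instance instIsMulRightInvariantHaarUnitary : (haarUnitary ι).IsMulRightInvariant := by
  refine ⟨fun g => ?_⟩
  have : IsProbabilityMeasure ((haarUnitary ι).map (· * g)) :=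
    Measure.isProbabilityMeasure_map (measurable_mul_const g).aemeasurable
  exact Measure.isHaarMeasure_eq_of_isProbabilityMeasure _ _

variable {ι}

theorem continuous_entry (i j : ι) :
    Continuous fun V : UGroup ι => (V : Matrix ι ι ℂ) i j :=
  (continuous_apply_apply i j).comp continuous_subtype_val

theorem integral_haar_mul_mul {E : Type*} [NormedAddCommGroup E] [NormedSpace ℝ E]
    (f : UGroup ι → E) (U U' : UGroup ι) :
    ∫ V, f (U * V * U') ∂haarUnitary ι = ∫ V, f V ∂haarUnitary ι :=
  (integral_mul_left_eq_self (fun V => f (V * U')) U).trans (integral_mul_right_eq_self f U')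

end Topology

theorem integrable_of_continuous {K E : Type*} [TopologicalSpace K] [CompactSpace K]
    [MeasurableSpace K] [BorelSpace K] [NormedAddCommGroup E] [SecondCountableTopology E]
    {ν : Measure K} [IsFiniteMeasure ν] {f : K → E} (hf : Continuous f) : Integrable f ν := by
  obtain ⟨C, hC⟩ := (isCompact_range hf).isBounded.exists_norm_le
  let : MeasurableSpace E := borel E
  have : BorelSpace E := ⟨rfl⟩
  exact Integrable.of_bound hf.measurable.aestronglyMeasurable C
    (Eventually.of_forall fun x => hC _ ⟨x, rfl⟩)

/-! ### Second moments of the entries of a Haar unitary -/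

/-- Two pairs which are not permutations of each other are told apart by a phase at one label. -/
theorem exists_phase_ne_one {ι : Type*} [DecidableEq ι] (a c : ι × ι) (h : ¬(c = a ∨ c = a.swap)) :
    ∃ p : ι → ℂ, (∀ i, star (p i) * p i = 1) ∧ p a.1 * p a.2 * star (p c.1 * p c.2) ≠ 1 := by
  have hI : ∀ i j : ι, star (if j = i then Complex.I else 1) *
      (if j = i then Complex.I else 1) = 1 := by
    intro i j
    split_ifs <;> simp
  have hneg : (-1 : ℂ) ≠ 1 := by norm_num
  have hI1 : Complex.I ≠ 1 := by simp [Complex.ext_iff]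
  obtain ⟨a1, a2⟩ := a
  obtain ⟨c1, c2⟩ := c
  simp only [Prod.swap_prod_mk, Prod.mk.injEq] at h
  -- A phase `I` at a label `i` produces `I ^ k` with `k` the number of occurrences of `i` in `a`
  -- minus that in `c`, so `|k| ≤ 2`, and `I ^ k ≠ 1` unless the two numbers agree.
  by_cases h1 : c1 = a1 ∨ c2 = a1
  · refine ⟨fun j => if j = a2 then Complex.I else 1, hI a2, ?_⟩
    rcases h1 with rfl | rfl
    · have h2 : c2 ≠ a2 := fun e => h (Or.inl ⟨rfl, e⟩)
      by_cases h3 : c1 = a2 <;> simp [h3, h2, hI1]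
    · have h2 : c1 ≠ a2 := fun e => h (Or.inr ⟨e, rfl⟩)
      by_cases h3 : c2 = a2 <;> simp [h3, h2, hI1]
  · push Not at h1
    refine ⟨fun j => if j = a1 then Complex.I else 1, hI a1, ?_⟩
    by_cases h3 : a2 = a1 <;> simp [h1, h3, hI1, hneg]

theorem two_le_card_of_ne {ι : Type*} [Fintype ι] {a a' : ι} (h : a ≠ a') :
    (2 : ℝ) ≤ Fintype.card ι := by
  exact_mod_cast Fintype.one_lt_card_iff.mpr ⟨a, a', h⟩

section Haar

variable {ι : Type} [Fintype ι] [DecidableEq ι]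

/-- The diagonal unitary with phases `p`. -/
def phaseUnitary (p : ι → ℂ) (hp : ∀ i, star (p i) * p i = 1) : UGroup ι :=
  ⟨Matrix.diagonal p, by
    rw [Matrix.mem_unitaryGroup_iff', Matrix.star_eq_conjTranspose, Matrix.diagonal_conjTranspose,
      Matrix.diagonal_mul_diagonal, ← Matrix.diagonal_one]
    exact congrArg _ (funext hp)⟩

/-- The permutation unitary `e_{σ i} ↦ e_i`. -/
def permUnitary (σ : Equiv.Perm ι) : UGroup ι :=
  ⟨σ.toPEquiv.toMatrix, by
    rw [Matrix.mem_unitaryGroup_iff, Matrix.star_eq_conjTranspose, PEquiv.toMatrix_toPEquiv_mul]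
    ext i j
    simp [PEquiv.toMatrix_apply, Matrix.one_apply]⟩

/-- The reflection with matrix `!![3/5, 4/5; 4/5, -3/5]` in the plane of `e_b` and `e_{b'}`. Any
reflection mixing the two would serve; this one has rational entries. -/
noncomputable def reflectionUnitary (b b' : ι) (h : b ≠ b') : UGroup ι :=
  -- The orthogonal reflection `1 - 2 u uᵀ / ⟨u, u⟩` along `u = e_b - 2 e_{b'}`.
  let u : ι → ℂ := Pi.single b 1 - Pi.single b' 2
  ⟨1 - (2 / 5 : ℂ) • Matrix.vecMulVec u u, by
    have hs : star u = u := by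
      simp only [u, star_sub, Pi.star_single, star_one, star_ofNat]
    have hu : u ⬝ᵥ u = 5 := by
      simp only [u, sub_dotProduct, single_dotProduct, Pi.sub_apply, Pi.single_eq_same,
        Pi.single_eq_of_ne h, Pi.single_eq_of_ne h.symm]
      norm_num
    have hE : Matrix.vecMulVec u u * Matrix.vecMulVec u u = (5 : ℂ) • Matrix.vecMulVec u u := by
      rw [Matrix.vecMulVec_mul_vecMulVec, hu]
      ext i j
      simp [Matrix.vecMulVec_apply]
      ring
    have hH : star (Matrix.vecMulVec u u) = Matrix.vecMulVec u u := by
      rw [Matrix.star_eq_conjTranspose, Matrix.conjTranspose_vecMulVec, hs]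
    have h25 : star (2 / 5 : ℂ) = 2 / 5 := by simp
    rw [Matrix.mem_unitaryGroup_iff, star_sub, star_one, star_smul, hH, h25, sub_mul, mul_sub,
      mul_sub, smul_mul_smul_comm, hE, smul_smul]
    simp only [mul_one, one_mul]
    have : (2 / 5 * (2 / 5) * 5 : ℂ) = 2 / 5 + 2 / 5 := by norm_num
    rw [this, add_smul]
    abel⟩

theorem mul_phaseUnitary_apply (V : UGroup ι) (p : ι → ℂ) (hp) (a b : ι) :
    ((V * phaseUnitary p hp : UGroup ι) : Matrix ι ι ℂ) a b = V.1 a b * p b := by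
  simp [phaseUnitary]

theorem phaseUnitary_mul_apply (V : UGroup ι) (p : ι → ℂ) (hp) (a b : ι) :
    ((phaseUnitary p hp * V : UGroup ι) : Matrix ι ι ℂ) a b = p a * V.1 a b := by
  simp [phaseUnitary]

theorem permUnitary_mul_apply (V : UGroup ι) (σ : Equiv.Perm ι) (a b : ι) :
    ((permUnitary σ * V : UGroup ι) : Matrix ι ι ℂ) a b = V.1 (σ a) b := by
  simp [permUnitary, PEquiv.toMatrix_toPEquiv_mul]

theorem mul_permUnitary_apply (V : UGroup ι) (σ : Equiv.Perm ι) (a b : ι) :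
    ((V * permUnitary σ : UGroup ι) : Matrix ι ι ℂ) a b = V.1 a (σ.symm b) := by
  simp [permUnitary, PEquiv.mul_toMatrix_toPEquiv]

theorem mul_reflectionUnitary_apply (V : UGroup ι) (b b' : ι) (h : b ≠ b') (a : ι) :
    ((V * reflectionUnitary b b' h : UGroup ι) : Matrix ι ι ℂ) a b =
      3 / 5 * V.1 a b + 4 / 5 * V.1 a b' := by
  simp only [reflectionUnitary, Submonoid.coe_mul, mul_sub, mul_one, Matrix.sub_apply,
    Matrix.mul_smul, Matrix.smul_apply, Matrix.mul_vecMulVec, Matrix.vecMulVec_apply,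
    Matrix.mulVec_sub, Pi.sub_apply, Pi.single_eq_same, Pi.single_eq_of_ne h, smul_eq_mul,
    Matrix.mulVec_single, Pi.smul_apply, Matrix.col_apply, MulOpposite.op_one, one_smul, sub_zero,
    MulOpposite.smul_eq_mul_unop, MulOpposite.unop_op]
  ring

theorem sum_row_mul_star (V : UGroup ι) (a a' : ι) :
    ∑ b, V.1 a b * star (V.1 a' b) = if a = a' then 1 else 0 := by
  have h := congrFun (congrFun (Matrix.mem_unitaryGroup_iff.mp V.2) a) a'
  simpa [Matrix.mul_apply, Matrix.one_apply] using h

theorem sum_col_mul_star (V : UGroup ι) (b b' : ι) :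
    ∑ a, V.1 a b * star (V.1 a b') = if b = b' then 1 else 0 := by
  have h := congrFun (congrFun (Matrix.mem_unitaryGroup_iff'.mp V.2) b') b
  simpa [Matrix.mul_apply, Matrix.one_apply, mul_comm, eq_comm] using h

theorem sum_row_norm_sq (V : UGroup ι) (a : ι) : ∑ b, ‖V.1 a b‖ ^ 2 = 1 := by
  have h := sum_row_mul_star V a a
  simp only [if_true, Complex.star_def, Complex.mul_conj'] at h
  exact_mod_cast h

theorem sum_col_norm_sq (V : UGroup ι) (b : ι) : ∑ a, ‖V.1 a b‖ ^ 2 = 1 := by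
  have h := sum_col_mul_star V b b
  simp only [if_true, Complex.star_def, Complex.mul_conj'] at h
  exact_mod_cast h

theorem sum_eq_add_card_sub_one_mul {R : Type*} [CommRing R] (f : ι → R) (i : ι) (y : R)
    (h : ∀ j, j ≠ i → f j = y) : ∑ j, f j = f i + (Fintype.card ι - 1) * y := by
  rw [← Finset.add_sum_erase _ _ (Finset.mem_univ i),
    Finset.sum_congr rfl fun j hj => h j (Finset.ne_of_mem_erase hj), Finset.sum_const,
    Finset.card_erase_of_mem (Finset.mem_univ i), Finset.card_univ, nsmul_eq_mul,
    Nat.cast_sub (Fintype.card_pos_iff.mpr ⟨i⟩)]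
  simp

/-- `𝔼[V_{a₁b₁} V_{a₂b₂} conj(V_{c₁d₁} V_{c₂d₂})]` for a unitary with law `ν`. -/
noncomputable def entryMoment (ν : Measure (UGroup ι)) (a b c d : ι × ι) : ℂ :=
  ∫ V, V.1 a.1 b.1 * V.1 a.2 b.2 * star (V.1 c.1 d.1 * V.1 c.2 d.2) ∂ν

theorem integrable_entries (ν : Measure (UGroup ι)) [IsFiniteMeasure ν] (a b c d : ι × ι) :
    Integrable (fun V : UGroup ι =>
      V.1 a.1 b.1 * V.1 a.2 b.2 * star (V.1 c.1 d.1 * V.1 c.2 d.2)) ν :=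
  integrable_of_continuous (((continuous_entry _ _).mul (continuous_entry _ _)).mul
    ((continuous_entry _ _).mul (continuous_entry _ _)).star)

/-- `𝔼[|V_{ab}|² |V_{a'b'}|²]` for a Haar unitary. -/
noncomputable def haarSqMoment (a b a' b' : ι) : ℝ :=
  ∫ V : UGroup ι, ‖V.1 a b‖ ^ 2 * ‖V.1 a' b'‖ ^ 2 ∂haarUnitary ι

theorem entryMoment_haar_eq_haarSqMoment (a b : ι × ι) :
    entryMoment (haarUnitary ι) a b a b = haarSqMoment a.1 b.1 a.2 b.2 := by
  rw [entryMoment, haarSqMoment, ← integral_complex_ofReal]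
  congr 1 with V
  push_cast
  rw [← Complex.mul_conj', ← Complex.mul_conj']
  simp only [star_mul', Complex.star_def]
  ring

theorem entryMoment_haar_perm (σ τ : Equiv.Perm ι) (a b c d : ι × ι) :
    entryMoment (haarUnitary ι) (Prod.map σ σ a) (Prod.map τ τ b) (Prod.map σ σ c)
      (Prod.map τ τ d) = entryMoment (haarUnitary ι) a b c d := by
  have h := integral_haar_mul_mul (fun V : UGroup ι =>
    V.1 a.1 b.1 * V.1 a.2 b.2 * star (V.1 c.1 d.1 * V.1 c.2 d.2)) (permUnitary σ)
    (permUnitary τ.symm)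
  simp only [mul_permUnitary_apply, permUnitary_mul_apply, Equiv.symm_symm] at h
  exact h

theorem haarSqMoment_perm (σ τ : Equiv.Perm ι) (a b a' b' : ι) :
    haarSqMoment (σ a) (τ b) (σ a') (τ b') = haarSqMoment a b a' b' := by
  have h := entryMoment_haar_perm σ τ (a, a') (b, b') (a, a') (b, b')
  simp only [Prod.map_apply, entryMoment_haar_eq_haarSqMoment] at h
  exact_mod_cast h

/-- The invariance under multiplying rows by phases `p` and columns by phases `q`. -/
theorem entryMoment_haar_phase (p q : ι → ℂ) (hp : ∀ i, star (p i) * p i = 1)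
    (hq : ∀ i, star (q i) * q i = 1) (a b c d : ι × ι) :
    (p a.1 * p a.2 * star (p c.1 * p c.2)) * (q b.1 * q b.2 * star (q d.1 * q d.2)) *
      entryMoment (haarUnitary ι) a b c d = entryMoment (haarUnitary ι) a b c d := by
  have h := integral_haar_mul_mul (fun V : UGroup ι =>
    V.1 a.1 b.1 * V.1 a.2 b.2 * star (V.1 c.1 d.1 * V.1 c.2 d.2)) (phaseUnitary p hp)
    (phaseUnitary q hq)
  simp only [mul_phaseUnitary_apply, phaseUnitary_mul_apply] at h
  rw [entryMoment, ← integral_const_mul]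
  refine Eq.trans (integral_congr_ae (Eventually.of_forall fun V => ?_)) h
  simp only [star_mul']
  ring

theorem entryMoment_haar_eq_zero_of_row (a b c d : ι × ι) (h : ¬(c = a ∨ c = a.swap)) :
    entryMoment (haarUnitary ι) a b c d = 0 := by
  obtain ⟨p, hp, hne⟩ := exists_phase_ne_one a c h
  have := entryMoment_haar_phase p (fun _ => 1) hp (by simp) a b c d
  by_contra h0
  exact hne (mul_right_cancel₀ h0 (by simpa using this))

theorem entryMoment_haar_eq_zero_of_col (a b c d : ι × ι) (h : ¬(d = b ∨ d = b.swap)) :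
    entryMoment (haarUnitary ι) a b c d = 0 := by
  obtain ⟨p, hp, hne⟩ := exists_phase_ne_one b d h
  have := entryMoment_haar_phase (fun _ => 1) p (by simp) hp a b c d
  by_contra h0
  exact hne (mul_right_cancel₀ h0 (by simpa using this))

theorem continuous_sq_mul_sq (a b a' b' : ι) :
    Continuous fun V : UGroup ι => ‖V.1 a b‖ ^ 2 * ‖V.1 a' b'‖ ^ 2 :=
  ((continuous_entry a b).norm.pow 2).mul ((continuous_entry a' b').norm.pow 2)

theorem integral_haar_norm_sq (a b : ι) :
    ∫ V : UGroup ι, ‖V.1 a b‖ ^ 2 ∂haarUnitary ι = 1 / Fintype.card ι := by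
  have hc : ∀ b', ∫ V : UGroup ι, ‖V.1 a b'‖ ^ 2 ∂haarUnitary ι =
      ∫ V : UGroup ι, ‖V.1 a b‖ ^ 2 ∂haarUnitary ι := by
    intro b'
    have h := integral_haar_mul_mul (fun V : UGroup ι => ‖V.1 a b‖ ^ 2) 1
      (permUnitary (Equiv.swap b b'))
    simpa only [one_mul, mul_permUnitary_apply, Equiv.symm_swap, Equiv.swap_apply_left] using h
  have hint : ∀ b', Integrable (fun V : UGroup ι => ‖V.1 a b'‖ ^ 2) (haarUnitary ι) :=
    fun b' => integrable_of_continuous ((continuous_entry a b').norm.pow 2)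
  have hsum : ∑ b', ∫ V : UGroup ι, ‖V.1 a b'‖ ^ 2 ∂haarUnitary ι = 1 := by
    rw [← integral_finsetSum _ fun b' _ => hint b']
    simp [sum_row_norm_sq]
  have hpos : (Fintype.card ι : ℝ) ≠ 0 :=
    Nat.cast_ne_zero.mpr (Fintype.card_pos_iff.mpr ⟨a⟩).ne'
  rw [Finset.sum_congr rfl fun b' _ => hc b'] at hsum
  rw [eq_div_iff hpos, mul_comm]
  simpa using hsum

theorem sum_haarSqMoment_row (a b a' : ι) :
    ∑ b', haarSqMoment a b a' b' = 1 / Fintype.card ι := by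
  simp only [haarSqMoment]
  rw [← integral_finsetSum _ fun b' _ => integrable_of_continuous (continuous_sq_mul_sq a b a' b')]
  simp [← Finset.mul_sum, sum_row_norm_sq, integral_haar_norm_sq]

theorem sum_haarSqMoment_col (a b b' : ι) :
    ∑ a', haarSqMoment a b a' b' = 1 / Fintype.card ι := by
  simp only [haarSqMoment]
  rw [← integral_finsetSum _ fun a' _ => integrable_of_continuous (continuous_sq_mul_sq a b a' b')]
  simp [← Finset.mul_sum, sum_col_norm_sq, integral_haar_norm_sq]

/-- Averaging over the relative phases `1, i, -1, -i` removes the cross terms of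
`|(3/5) u + (4/5) v|⁴` except `|u|² |v|²`. -/
theorem norm_pow_four_phase_average (u v : ℂ) :
    ‖3 / 5 * u + 4 / 5 * (v * 1)‖ ^ 4 + ‖3 / 5 * u + 4 / 5 * (v * Complex.I)‖ ^ 4 +
      ‖3 / 5 * u + 4 / 5 * (v * -1)‖ ^ 4 + ‖3 / 5 * u + 4 / 5 * (v * -Complex.I)‖ ^ 4 =
    4 * ((3 / 5) ^ 4 * (‖u‖ ^ 2 * ‖u‖ ^ 2) + (4 / 5) ^ 4 * (‖v‖ ^ 2 * ‖v‖ ^ 2) +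
      4 * (3 / 5) ^ 2 * (4 / 5) ^ 2 * (‖u‖ ^ 2 * ‖v‖ ^ 2)) := by
  have h4 : ∀ z : ℂ, ‖z‖ ^ 4 = (z.re * z.re + z.im * z.im) ^ 2 := fun z => by
    rw [← Complex.normSq_apply, Complex.normSq_eq_norm_sq]; ring
  have h2 : ∀ z : ℂ, ‖z‖ ^ 2 = z.re * z.re + z.im * z.im := fun z => by
    rw [← Complex.normSq_apply, Complex.normSq_eq_norm_sq]
  have e3 : (3 / 5 : ℂ) = ((3 / 5 : ℝ) : ℂ) := by push_cast; rfl
  have e4 : (4 / 5 : ℂ) = ((4 / 5 : ℝ) : ℂ) := by push_cast; rfl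
  rw [e3, e4]
  simp only [h4, h2, Complex.add_re, Complex.add_im, Complex.re_ofReal_mul, Complex.im_ofReal_mul]
  simp only [Complex.mul_re, Complex.mul_im, Complex.one_re, Complex.one_im, Complex.I_re,
    Complex.I_im, Complex.neg_re, Complex.neg_im]
  ring

/-- Since `(3/5) V_{ab} + (4/5) c V_{ab'}` has the law of `V_{ab}` for every phase `c`, averaging
its fourth moment over `c` relates `𝔼|V_{ab}|⁴` to `𝔼|V_{ab}|²|V_{ab'}|²`. -/
theorem haarSqMoment_self_eq_two_mul (a b b' : ι) (h : b ≠ b') :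
    haarSqMoment a b a b = 2 * haarSqMoment a b a b' := by
  have hphase : ∀ c : ℂ, star c * c = 1 →
      ∫ V : UGroup ι, ‖3 / 5 * V.1 a b + 4 / 5 * (V.1 a b' * c)‖ ^ 4 ∂haarUnitary ι =
        haarSqMoment a b a b := by
    intro c hc
    have hq : ∀ i, star (if i = b' then c else 1) * (if i = b' then c else 1) = 1 := by
      intro i
      split_ifs
      · exact hc
      · simp
    have := integral_haar_mul_mul (fun V : UGroup ι => ‖V.1 a b‖ ^ 2 * ‖V.1 a b‖ ^ 2) 1
      (phaseUnitary (fun i => if i = b' then c else 1) hq * reflectionUnitary b b' h)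
    rw [haarSqMoment, ← this]
    congr 1 with V
    have e : ((1 * V * (phaseUnitary (fun i => if i = b' then c else 1) hq *
        reflectionUnitary b b' h) : UGroup ι) : Matrix ι ι ℂ) a b =
        3 / 5 * V.1 a b + 4 / 5 * (V.1 a b' * c) := by
      rw [one_mul, ← mul_assoc, mul_reflectionUnitary_apply, mul_phaseUnitary_apply,
        mul_phaseUnitary_apply, if_neg h, if_pos rfl, mul_one]
    rw [e]
    ring
  have hint : ∀ c : ℂ, Integrable (fun V : UGroup ι =>
      ‖3 / 5 * V.1 a b + 4 / 5 * (V.1 a b' * c)‖ ^ 4) (haarUnitary ι) := fun c =>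
    integrable_of_continuous ((((continuous_const.mul (continuous_entry a b)).add
      (continuous_const.mul ((continuous_entry a b').mul continuous_const))).norm).pow 4)
  have hsq : ∀ a b a' b', Integrable (fun V : UGroup ι => ‖V.1 a b‖ ^ 2 * ‖V.1 a' b'‖ ^ 2)
      (haarUnitary ι) := fun a b a' b' => integrable_of_continuous (continuous_sq_mul_sq a b a' b')
  have hadd : ∀ f g : UGroup ι → ℝ, Integrable f (haarUnitary ι) → Integrable g (haarUnitary ι) →
      Integrable (fun V => f V + g V) (haarUnitary ι) := fun f g hf hg => hf.add hg
  have key := integral_congr_ae (μ := haarUnitary ι)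
    (Eventually.of_forall fun V : UGroup ι => norm_pow_four_phase_average (V.1 a b) (V.1 a b'))
  rw [integral_add (hadd _ _ (hadd _ _ (hint 1) (hint _)) (hint _)) (hint _),
    integral_add (hadd _ _ (hint 1) (hint _)) (hint _), integral_add (hint 1) (hint _),
    hphase _ (by simp), hphase _ (by simp), hphase _ (by simp), hphase _ (by simp),
    integral_const_mul, integral_add (hadd _ _ ((hsq _ _ _ _).const_mul _)
      ((hsq _ _ _ _).const_mul _)) ((hsq _ _ _ _).const_mul _),
    integral_add ((hsq _ _ _ _).const_mul _) ((hsq _ _ _ _).const_mul _), integral_const_mul,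
    integral_const_mul, integral_const_mul] at key
  have hswap : haarSqMoment a b' a b' = haarSqMoment a b a b := by
    simpa using haarSqMoment_perm 1 (Equiv.swap b b') a b a b
  simp only [haarSqMoment] at key hswap ⊢
  rw [hswap] at key
  linarith

/-- The squared norms in a row add up to one, which fixes the value once
`𝔼|V_{ab}|⁴ = 2 𝔼|V_{ab}|²|V_{ab'}|²` is known. -/
theorem haarSqMoment_self (a b : ι) :
    haarSqMoment a b a b = 2 / (Fintype.card ι * (Fintype.card ι + 1)) := by
  have h := sum_haarSqMoment_row a b a
  rw [sum_eq_add_card_sub_one_mul _ b (haarSqMoment a b a b / 2)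
    fun b' hb' => by linarith [haarSqMoment_self_eq_two_mul a b b' hb'.symm]] at h
  have hpos : (0 : ℝ) < Fintype.card ι := Nat.cast_pos.mpr (Fintype.card_pos_iff.mpr ⟨a⟩)
  field_simp at h ⊢
  linarith

theorem haarSqMoment_same_row (a b b' : ι) (h : b ≠ b') :
    haarSqMoment a b a b' = 1 / (Fintype.card ι * (Fintype.card ι + 1)) := by
  have h1 := haarSqMoment_self_eq_two_mul a b b' h
  rw [haarSqMoment_self] at h1
  have e : (2 : ℝ) / (Fintype.card ι * (Fintype.card ι + 1)) =
    2 * (1 / (Fintype.card ι * (Fintype.card ι + 1))) := by ring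
  linarith

theorem haarSqMoment_same_col (a a' b : ι) (h : a ≠ a') :
    haarSqMoment a b a' b = 1 / (Fintype.card ι * (Fintype.card ι + 1)) := by
  have hs := sum_haarSqMoment_col a b b
  rw [sum_eq_add_card_sub_one_mul _ a (haarSqMoment a b a' b), haarSqMoment_self] at hs
  · have h2 := two_le_card_of_ne h
    have h3 : (Fintype.card ι : ℝ) - 1 ≠ 0 := by linarith
    refine mul_left_cancel₀ h3 ?_
    have h4 : ((Fintype.card ι : ℝ) - 1) * haarSqMoment a b a' b = 1 / Fintype.card ι -
      2 / (Fintype.card ι * (Fintype.card ι + 1)) := by linarith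
    rw [h4]
    field_simp
    ring
  · intro c hc
    have := haarSqMoment_perm (Equiv.swap a' c) 1 a b a' b
    rw [Equiv.swap_apply_left, Equiv.swap_apply_of_ne_of_ne h hc.symm] at this
    exact this

theorem haarSqMoment_of_ne (a a' b b' : ι) (h : a ≠ a') (hb : b ≠ b') :
    haarSqMoment a b a' b' = 1 / ((Fintype.card ι : ℝ) ^ 2 - 1) := by
  have hs := sum_haarSqMoment_row a b a'
  rw [sum_eq_add_card_sub_one_mul _ b (haarSqMoment a b a' b'), haarSqMoment_same_col _ _ _ h] at hs
  · have h2 := two_le_card_of_ne h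
    have h3 : (Fintype.card ι : ℝ) - 1 ≠ 0 := by linarith
    have h5 : (Fintype.card ι : ℝ) ^ 2 - 1 ≠ 0 := by nlinarith
    refine mul_left_cancel₀ h3 ?_
    have h4 : ((Fintype.card ι : ℝ) - 1) * haarSqMoment a b a' b' = 1 / Fintype.card ι -
      1 / (Fintype.card ι * (Fintype.card ι + 1)) := by linarith
    rw [h4]
    field_simp
    ring
  · intro c hc
    have := haarSqMoment_perm 1 (Equiv.swap b' c) a b a' b'
    rw [Equiv.swap_apply_left, Equiv.swap_apply_of_ne_of_ne hb hc.symm] at this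
    exact this

/-- The only kind of moment which is not an expectation of squared moduli; its value comes from the
orthogonality of the rows `a` and `a'`. -/
theorem entryMoment_haar_exchange (a a' b b' : ι) (h : a ≠ a') (hb : b ≠ b') :
    entryMoment (haarUnitary ι) (a, a') (b, b') (a, a') (b', b) =
      -1 / (Fintype.card ι * ((Fintype.card ι : ℂ) ^ 2 - 1)) := by
  have hs : ∑ c, entryMoment (haarUnitary ι) (a, a') (b, c) (a, a') (c, b) = 0 := by
    simp only [entryMoment]
    rw [← integral_finsetSum _ fun c _ => integrable_entries _ (a, a') (b, c) (a, a') (c, b)]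
    refine (integral_congr_ae (Eventually.of_forall fun V => ?_)).trans (integral_zero _ _)
    have : ∀ c, V.1 a b * V.1 a' c * star (V.1 a c * V.1 a' b) =
        V.1 a b * star (V.1 a' b) * (V.1 a' c * star (V.1 a c)) := fun c => by
      rw [star_mul']; ring
    simp only [this, ← Finset.mul_sum, sum_row_mul_star, if_neg h.symm, mul_zero]
  rw [sum_eq_add_card_sub_one_mul _ b (entryMoment (haarUnitary ι) (a, a') (b, b') (a, a') (b', b)),
    entryMoment_haar_eq_haarSqMoment, haarSqMoment_same_col _ _ _ h] at hs
  · have h2 := two_le_card_of_ne h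
    have h3 : (Fintype.card ι : ℂ) - 1 ≠ 0 := by
      have : (Fintype.card ι : ℝ) - 1 ≠ 0 := by linarith
      exact_mod_cast this
    have h5 : (Fintype.card ι : ℂ) ^ 2 - 1 ≠ 0 := by
      have : (Fintype.card ι : ℝ) ^ 2 - 1 ≠ 0 := by nlinarith
      exact_mod_cast this
    have h6 : (Fintype.card ι : ℂ) + 1 ≠ 0 := by
      have : (Fintype.card ι : ℝ) + 1 ≠ 0 := by linarith
      exact_mod_cast this
    have h7 : (Fintype.card ι : ℂ) ≠ 0 := by
      have : (Fintype.card ι : ℝ) ≠ 0 := by linarith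
      exact_mod_cast this
    refine mul_left_cancel₀ h3 ?_
    rw [eq_neg_of_add_eq_zero_right hs]
    push_cast
    field_simp
    ring
  · intro c hc
    have := entryMoment_haar_perm 1 (Equiv.swap b' c) (a, a') (b, b') (a, a') (b', b)
    simp only [Prod.map_apply, Equiv.swap_apply_left, Equiv.swap_apply_of_ne_of_ne hb hc.symm]
      at this
    exact this

/-- The right-hand side of the Weingarten formula for the moments of degree `(2, 2)`: a sum over
pairs of permutations of two letters, one matching rows and one matching columns, with weight
`1 / (d² - 1)` if they agree and `-1 / (d (d² - 1))` if not. It is meaningless for `d = 1`, where it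
divides by zero. -/
noncomputable def weingartenTwo (a b c d : ι × ι) : ℂ :=
  ((if c = a then 1 else 0) * (if d = b then 1 else 0) +
      (if c = a.swap then 1 else 0) * (if d = b.swap then 1 else 0)) /
    ((Fintype.card ι : ℂ) ^ 2 - 1) -
  ((if c = a then 1 else 0) * (if d = b.swap then 1 else 0) +
      (if c = a.swap then 1 else 0) * (if d = b then 1 else 0)) /
    (Fintype.card ι * ((Fintype.card ι : ℂ) ^ 2 - 1))

theorem entryMoment_swap (ν : Measure (UGroup ι)) (a b c d : ι × ι) :
    entryMoment ν a b c.swap d.swap = entryMoment ν a b c d := by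
  simp only [entryMoment, Prod.fst_swap, Prod.snd_swap]
  congr 1 with V
  rw [mul_comm (V.1 c.2 d.2)]

theorem weingartenTwo_swap (a b c d : ι × ι) :
    weingartenTwo a b c.swap d.swap = weingartenTwo a b c d := by
  have h1 : ∀ x y : ι × ι, x.swap = y ↔ x = y.swap := fun x y => by
    constructor <;> rintro rfl <;> simp
  simp only [weingartenTwo, h1, Prod.swap_swap]
  ring

theorem entryMoment_haar (hι : 2 ≤ Fintype.card ι) (a b c d : ι × ι) :
    entryMoment (haarUnitary ι) a b c d = weingartenTwo a b c d := by
  have h2 : (2 : ℝ) ≤ Fintype.card ι := by exact_mod_cast hι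
  have h5 : (Fintype.card ι : ℂ) ^ 2 - 1 ≠ 0 := by
    have : (Fintype.card ι : ℝ) ^ 2 - 1 ≠ 0 := by nlinarith
    exact_mod_cast this
  have h6 : (Fintype.card ι : ℂ) + 1 ≠ 0 := by
    have : (Fintype.card ι : ℝ) + 1 ≠ 0 := by linarith
    exact_mod_cast this
  have h7 : (Fintype.card ι : ℂ) ≠ 0 := by
    have : (Fintype.card ι : ℝ) ≠ 0 := by linarith
    exact_mod_cast this
  -- It is enough to treat `c = a`, since the pairs `c` and `d` may be swapped together.
  have main : ∀ d, (d = b ∨ d = b.swap) →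
      entryMoment (haarUnitary ι) a b a d = weingartenTwo a b a d := by
    obtain ⟨a, a'⟩ := a
    obtain ⟨b, b'⟩ := b
    by_cases hb : b = b'
    · subst hb
      intro d hd
      have : d = (b, b) := by simpa using hd
      subst this
      rw [entryMoment_haar_eq_haarSqMoment]
      by_cases ha : a = a'
      · subst ha
        simp only [haarSqMoment_self, weingartenTwo, Prod.swap_prod_mk, if_true]
        push_cast
        field_simp
        ring
      · simp only [haarSqMoment_same_col _ _ _ ha, weingartenTwo, Prod.swap_prod_mk, if_true,
          Prod.mk.injEq, ha, false_and, if_false]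
        push_cast
        field_simp
        ring
    · rintro d (rfl | rfl)
      · rw [entryMoment_haar_eq_haarSqMoment]
        by_cases ha : a = a'
        · subst ha
          simp only [haarSqMoment_same_row _ _ _ hb, weingartenTwo, Prod.swap_prod_mk, if_true,
            Prod.mk.injEq, hb, false_and, if_false]
          push_cast
          field_simp
          ring
        · simp only [haarSqMoment_of_ne _ _ _ _ ha hb, weingartenTwo, Prod.swap_prod_mk, if_true,
            Prod.mk.injEq, ha, hb, false_and, if_false]
          push_cast
          ring
      · by_cases ha : a = a'
        · subst ha
          have : entryMoment (haarUnitary ι) (a, a) (b, b') (a, a) (b, b').swap =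
              entryMoment (haarUnitary ι) (a, a) (b, b') (a, a) (b, b') :=
            entryMoment_swap _ (a, a) (b, b') (a, a) (b, b')
          rw [this, entryMoment_haar_eq_haarSqMoment]
          simp only [haarSqMoment_same_row _ _ _ hb, weingartenTwo, Prod.swap_prod_mk, if_true,
            Prod.mk.injEq, hb, Ne.symm hb, false_and, if_false]
          push_cast
          field_simp
          ring
        · simp only [Prod.swap_prod_mk, entryMoment_haar_exchange _ _ _ _ ha hb, weingartenTwo,
            if_true, Prod.mk.injEq, ha, hb, Ne.symm hb, false_and, if_false]
          ring
  by_cases hd : d = b ∨ d = b.swap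
  · by_cases hc : c = a
    · subst hc
      exact main d hd
    · by_cases hc' : c = a.swap
      · subst hc'
        rw [← entryMoment_swap, ← weingartenTwo_swap, Prod.swap_swap]
        refine main _ (hd.symm.imp (fun h => ?_) fun h => ?_) <;> simp [h]
      · rw [entryMoment_haar_eq_zero_of_row _ _ _ _ (by simp [hc, hc'])]
        simp [weingartenTwo, hc, hc']
  · rw [entryMoment_haar_eq_zero_of_col _ _ _ _ hd]
    push Not at hd
    simp [weingartenTwo, hd.1, hd.2]

end Haar

/-! ### Moments of designs -/

section Moments

variable {ι : Type} [Fintype ι] [DecidableEq ι]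

theorem integral_haar_entry_mul_star (a b c d : ι) :
    ∫ V : UGroup ι, V.1 a b * star (V.1 c d) ∂haarUnitary ι =
      (if (c, d) = (a, b) then 1 else 0) / Fintype.card ι := by
  have hphase : ∀ i j : ι, star (if j = i then Complex.I else 1) *
      (if j = i then Complex.I else 1) = 1 := by
    intro i j
    split_ifs <;> simp
  have hI : Complex.I ≠ 1 := by simp [Complex.ext_iff]
  by_cases hc : c = a
  · by_cases hd : d = b
    · subst hc hd
      have h := congrArg (Complex.ofReal) (integral_haar_norm_sq c d)
      rw [← integral_complex_ofReal] at h
      simp only [Complex.star_def, Complex.mul_conj', if_true]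
      push_cast at h
      exact h
    · have h := integral_haar_mul_mul (fun V : UGroup ι => V.1 a b * star (V.1 c d)) 1
        (phaseUnitary (fun j => if j = b then Complex.I else 1) (hphase b))
      simp only [one_mul, mul_phaseUnitary_apply, if_true, if_neg hd, mul_one,
        mul_right_comm _ Complex.I] at h
      rw [integral_mul_const] at h
      rw [if_neg (by simp [hd]), zero_div]
      by_contra h0
      exact hI (mul_left_cancel₀ h0 (by simpa using h))
  · have h := integral_haar_mul_mul (fun V : UGroup ι => V.1 a b * star (V.1 c d))
      (phaseUnitary (fun j => if j = a then Complex.I else 1) (hphase a)) 1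
    simp only [mul_one, phaseUnitary_mul_apply, if_true, if_neg hc, one_mul, mul_assoc] at h
    rw [integral_const_mul] at h
    rw [if_neg (by simp [hc]), zero_div]
    by_contra h0
    exact hI (mul_right_cancel₀ h0 (by simpa using h))

/-- The operator `1 ⊗ R` on `t + 1` factors reduces a `(t + 1)`-design to a `t`-design, as
`A 1 A† = 1`. -/
theorem tensorPow_conj_apply_succ (t : ℕ) (A : UGroup ι)
    (R : Matrix (Fin t → ι) (Fin t → ι) ℂ) (a : ι) (i j : Fin t → ι) :
    (tensorPow (t + 1) (A : Matrix ι ι ℂ) *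
        (Matrix.of fun k l : Fin (t + 1) → ι =>
          (if k 0 = l 0 then 1 else 0) * R (Fin.tail k) (Fin.tail l)) *
        tensorPow (t + 1) (A : Matrix ι ι ℂ).conjTranspose) (Fin.cons a i) (Fin.cons a j) =
      (tensorPow t (A : Matrix ι ι ℂ) * R * tensorPow t (A : Matrix ι ι ℂ).conjTranspose) i j := by
  have hsum : ∀ f : (Fin (t + 1) → ι) → ℂ,
      ∑ k, f k = ∑ x : ι, ∑ y : Fin t → ι, f (Fin.cons x y) := by
    intro f
    rw [← (Fin.consEquiv fun _ => ι).sum_comp f, Fintype.sum_prod_type]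
    rfl
  simp only [Matrix.mul_apply, hsum, tensorPow, Matrix.of_apply, Fin.prod_univ_succ, Fin.cons_zero,
    Fin.cons_succ, Fin.tail_cons, Finset.sum_mul]
  have hrow := sum_row_mul_star A a a
  rw [if_pos rfl] at hrow
  calc _ = ∑ x, ∑ y : Fin t → ι, ∑ z : Fin t → ι, (A.1 a x * star (A.1 a x)) *
        ((∏ s, A.1 (i s) (z s)) * R z y * ∏ s, A.1.conjTranspose (y s) (j s)) := by
        refine Finset.sum_congr rfl fun x _ => Finset.sum_congr rfl fun y _ => ?_
        rw [Finset.sum_comm]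
        refine Finset.sum_congr rfl fun z _ => ?_
        rw [Finset.sum_eq_single x]
        · simp only [if_true, Matrix.conjTranspose_apply]
          ring
        · intro w _ hw
          simp [hw]
        · simp
    _ = _ := by
        simp only [← Finset.mul_sum, ← Finset.sum_mul, hrow, one_mul]

theorem IsTDesign.of_succ [Nonempty ι] {Ω : Type*} [MeasurableSpace Ω] {P : Measure Ω} {t : ℕ}
    {W : Ω → UGroup ι} (h : IsTDesign P (t + 1) W) : IsTDesign P t W := by
  intro R i j
  obtain ⟨a⟩ := ‹Nonempty ι›
  have := h (Matrix.of fun k l => (if k 0 = l 0 then 1 else 0) * R (Fin.tail k) (Fin.tail l))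
    (Fin.cons a i) (Fin.cons a j)
  simpa only [tensorPow_conj_apply_succ] using this

theorem IsTDesign.mono [Nonempty ι] {Ω : Type*} [MeasurableSpace Ω] {P : Measure Ω} {s t : ℕ}
    {W : Ω → UGroup ι} (h : IsTDesign P t W) (hst : s ≤ t) : IsTDesign P s W := by
  induction t, hst using Nat.le_induction with
  | base => exact h
  | succ t _ ih => exact ih h.of_succ

/-- Matrix units select single moments of the entries of `A`. -/
theorem tensorPow_mul_single_mul (t : ℕ) (A : Matrix ι ι ℂ) (i j k l : Fin t → ι) :
    (tensorPow t A * Matrix.single k l (1 : ℂ) * tensorPow t A.conjTranspose) i j =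
      (∏ s, A (i s) (k s)) * ∏ s, star (A (j s) (l s)) := by
  rw [Matrix.mul_apply, Finset.sum_eq_single l]
  · simp [tensorPow]
  · intro b _ hb
    simp [Matrix.mul_single_apply_of_ne _ _ _ _ _ hb]
  · simp

theorem IsTDesign.integral_entry_mul_star {Ω : Type*} [MeasurableSpace Ω] {P : Measure Ω}
    {W : Ω → UGroup ι} (h : IsTDesign P 1 W) (hW : Measurable W) (a b c d : ι) :
    ∫ V, V.1 a b * star (V.1 c d) ∂P.map W =
      (if (c, d) = (a, b) then 1 else 0) / Fintype.card ι := by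
  have := h (Matrix.single ![b] ![d] (1 : ℂ)) ![a] ![c]
  simp only [tensorPow_mul_single_mul, Fin.prod_univ_one, Matrix.cons_val_zero] at this
  rw [← integral_haar_entry_mul_star, ← this, integral_map hW.aemeasurable]
  exact ((continuous_entry _ _).mul
    (continuous_entry _ _).star).measurable.aestronglyMeasurable

theorem IsTDesign.entryMoment_eq {Ω : Type*} [MeasurableSpace Ω] {P : Measure Ω}
    {W : Ω → UGroup ι} (h : IsTDesign P 2 W) (hW : Measurable W) (hι : 2 ≤ Fintype.card ι)
    (a b c d : ι × ι) : entryMoment (P.map W) a b c d = weingartenTwo a b c d := by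
  have := h (Matrix.single ![b.1, b.2] ![d.1, d.2] (1 : ℂ)) ![a.1, a.2] ![c.1, c.2]
  simp only [tensorPow_mul_single_mul, Fin.prod_univ_two, Matrix.cons_val_zero,
    Matrix.cons_val_one, ← star_mul'] at this
  rw [← entryMoment_haar hι, entryMoment, entryMoment, ← this, integral_map hW.aemeasurable]
  exact (((continuous_entry _ _).mul (continuous_entry _ _)).mul
    ((continuous_entry _ _).mul (continuous_entry _ _)).star).measurable.aestronglyMeasurable

/-! ### Fourth moments of linear forms in the entries -/

/-- The linear form `∑ v_{ab} V_{ab}` in the entries of `V`. -/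
def entryForm (v : ι × ι → ℂ) (V : UGroup ι) : ℂ := ∑ x, v x * V.1 x.1 x.2

theorem continuous_entryForm (v : ι × ι → ℂ) : Continuous (entryForm v) :=
  continuous_finsetSum _ fun x _ => continuous_const.mul (continuous_entry x.1 x.2)

/-- The Weingarten formula with the indices grouped by matrix entry instead of by rows and
columns. -/
theorem weingartenTwo_eq_pairs (x y u w : ι × ι) :
    weingartenTwo (x.1, y.1) (x.2, y.2) (u.1, w.1) (u.2, w.2) =
      ((if (u, w) = (x, y) then 1 else 0) + (if (u, w) = (y, x) then 1 else 0)) /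
          ((Fintype.card ι : ℂ) ^ 2 - 1) -
        ((if (u, w) = ((x.1, y.2), (y.1, x.2)) then 1 else 0) +
          (if (u, w) = ((y.1, x.2), (x.1, y.2)) then 1 else 0)) /
          (Fintype.card ι * ((Fintype.card ι : ℂ) ^ 2 - 1)) := by
  obtain ⟨x1, x2⟩ := x
  obtain ⟨y1, y2⟩ := y
  obtain ⟨u1, u2⟩ := u
  obtain ⟨w1, w2⟩ := w
  have hite : ∀ p q r s : Prop, ∀ [Decidable p] [Decidable q] [Decidable r] [Decidable s],
      (if p ∧ q then (1 : ℂ) else 0) * (if r ∧ s then 1 else 0) =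
        if (p ∧ r) ∧ (q ∧ s) then 1 else 0 := by
    intro p q r s _ _ _ _
    by_cases p <;> by_cases q <;> by_cases r <;> by_cases s <;> simp_all
  simp only [weingartenTwo, Prod.swap_prod_mk, Prod.mk.injEq, hite]

theorem integral_norm_entryForm_pow_four {ν : Measure (UGroup ι)} [IsProbabilityMeasure ν]
    (hν : ∀ a b c d, entryMoment ν a b c d = weingartenTwo a b c d) (v : ι × ι → ℂ) :
    ((∫ V, ‖entryForm v V‖ ^ 4 ∂ν : ℝ) : ℂ) =
      2 * ((∑ x, ‖v x‖ ^ 2 : ℝ) : ℂ) ^ 2 / ((Fintype.card ι : ℂ) ^ 2 - 1) -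
        2 * (∑ x, ∑ y, v x * v y * star (v (x.1, y.2) * v (y.1, x.2))) /
          (Fintype.card ι * ((Fintype.card ι : ℂ) ^ 2 - 1)) := by
  -- `‖F‖⁴ = F² conj(F²)` expanded over pairs of index pairs.
  have hexp : ∀ V : UGroup ι, ((‖entryForm v V‖ ^ 4 : ℝ) : ℂ) =
      ∑ z : (ι × ι) × (ι × ι), ∑ z' : (ι × ι) × (ι × ι),
        (v z.1 * v z.2 * star (v z'.1 * v z'.2)) *
          (V.1 z.1.1 z.1.2 * V.1 z.2.1 z.2.2 *
            star (V.1 z'.1.1 z'.1.2 * V.1 z'.2.1 z'.2.2)) := by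
    intro V
    have h1 : entryForm v V * entryForm v V = ∑ z : (ι × ι) × (ι × ι),
        (v z.1 * v z.2) * (V.1 z.1.1 z.1.2 * V.1 z.2.1 z.2.2) := by
      rw [entryForm, Finset.sum_mul_sum, Fintype.sum_prod_type' fun x y : ι × ι =>
        (v x * v y) * (V.1 x.1 x.2 * V.1 y.1 y.2)]
      exact Finset.sum_congr rfl fun x _ => Finset.sum_congr rfl fun y _ => by ring
    have h2 : ((‖entryForm v V‖ ^ 4 : ℝ) : ℂ) = entryForm v V * entryForm v V *
        star (entryForm v V * entryForm v V) := by
      rw [Complex.star_def, Complex.mul_conj', norm_mul]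
      push_cast
      ring
    rw [h2, h1, star_sum, Finset.sum_mul_sum]
    refine Finset.sum_congr rfl fun x _ => Finset.sum_congr rfl fun y _ => ?_
    simp only [star_mul']
    ring
  have hint : ∀ z z' : (ι × ι) × (ι × ι), Integrable (fun V : UGroup ι =>
      (v z.1 * v z.2 * star (v z'.1 * v z'.2)) *
          (V.1 z.1.1 z.1.2 * V.1 z.2.1 z.2.2 *
            star (V.1 z'.1.1 z'.1.2 * V.1 z'.2.1 z'.2.2))) ν := fun z z' =>
    (integrable_entries ν (z.1.1, z.2.1) (z.1.2, z.2.2) (z'.1.1, z'.2.1)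
      (z'.1.2, z'.2.2)).const_mul _
  have hmom : ∀ z z' : (ι × ι) × (ι × ι), ∫ V : UGroup ι,
      (v z.1 * v z.2 * star (v z'.1 * v z'.2)) *
          (V.1 z.1.1 z.1.2 * V.1 z.2.1 z.2.2 *
            star (V.1 z'.1.1 z'.1.2 * V.1 z'.2.1 z'.2.2)) ∂ν =
      (v z.1 * v z.2 * star (v z'.1 * v z'.2)) *
        (((if z' = z then 1 else 0) + (if z' = (z.2, z.1) then 1 else 0)) /
          ((Fintype.card ι : ℂ) ^ 2 - 1) -
        ((if z' = ((z.1.1, z.2.2), (z.2.1, z.1.2)) then 1 else 0) +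
          (if z' = ((z.2.1, z.1.2), (z.1.1, z.2.2)) then 1 else 0)) /
          (Fintype.card ι * ((Fintype.card ι : ℂ) ^ 2 - 1))) := by
    intro z z'
    rw [integral_const_mul]
    congr 1
    exact (hν (z.1.1, z.2.1) (z.1.2, z.2.2) (z'.1.1, z'.2.1) (z'.1.2, z'.2.2)).trans
      (weingartenTwo_eq_pairs z.1 z.2 z'.1 z'.2)
  rw [← integral_complex_ofReal, integral_congr_ae (Eventually.of_forall hexp),
    integral_finsetSum _ fun z _ => integrable_finsetSum _ fun z' _ => hint z z']
  have hinner : ∀ z : (ι × ι) × (ι × ι), ∫ V : UGroup ι, ∑ z' : (ι × ι) × (ι × ι),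
      (v z.1 * v z.2 * star (v z'.1 * v z'.2)) *
          (V.1 z.1.1 z.1.2 * V.1 z.2.1 z.2.2 *
            star (V.1 z'.1.1 z'.1.2 * V.1 z'.2.1 z'.2.2)) ∂ν =
      2 / ((Fintype.card ι : ℂ) ^ 2 - 1) * (((‖v z.1‖ ^ 2 : ℝ) : ℂ) * ((‖v z.2‖ ^ 2 : ℝ) : ℂ)) -
      2 / (Fintype.card ι * ((Fintype.card ι : ℂ) ^ 2 - 1)) *
        (v z.1 * v z.2 * star (v (z.1.1, z.2.2) * v (z.2.1, z.1.2))) := by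
    intro z
    rw [integral_finsetSum _ fun z' _ => hint z z', Finset.sum_congr rfl fun z' _ => hmom z z']
    simp only [mul_sub, add_div, mul_add, Finset.sum_sub_distrib, Finset.sum_add_distrib, ite_div,
      mul_ite, zero_div, mul_zero, Finset.sum_ite_eq', Finset.mem_univ, if_true]
    push_cast
    rw [← Complex.mul_conj', ← Complex.mul_conj']
    simp only [star_mul', Complex.star_def]
    ring
  rw [Finset.sum_congr rfl fun z _ => hinner z, Finset.sum_sub_distrib, ← Finset.mul_sum,
    ← Finset.mul_sum, Fintype.sum_prod_type' fun x y : ι × ι =>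
      (((‖v x‖ ^ 2 : ℝ) : ℂ) * ((‖v y‖ ^ 2 : ℝ) : ℂ)),
    Fintype.sum_prod_type' fun x y : ι × ι => v x * v y * star (v (x.1, y.2) * v (y.1, x.2)),
    ← Finset.sum_mul_sum, ← Complex.ofReal_sum]
  ring

/-- The forms `V ↦ ⟨φ|V|ψ⟩` are those with `v_{ab} = p_a q_b`, where `p = conj φ` and `q = ψ`. -/
theorem integral_norm_entryForm_pow_four_of_product {ν : Measure (UGroup ι)}
    [IsProbabilityMeasure ν] (hι : 2 ≤ Fintype.card ι)
    (hν : ∀ a b c d, entryMoment ν a b c d = weingartenTwo a b c d) (p q : ι → ℂ) :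
    ∫ V, ‖entryForm (fun x => p x.1 * q x.2) V‖ ^ 4 ∂ν =
      2 / (Fintype.card ι * (Fintype.card ι + 1)) * ((∑ a, ‖p a‖ ^ 2) * ∑ b, ‖q b‖ ^ 2) ^ 2 := by
  have h := integral_norm_entryForm_pow_four hν (fun x => p x.1 * q x.2)
  have hS : ∑ x : ι × ι, ‖p x.1 * q x.2‖ ^ 2 = (∑ a, ‖p a‖ ^ 2) * ∑ b, ‖q b‖ ^ 2 := by
    rw [Finset.sum_mul_sum, Fintype.sum_prod_type]
    simp only [norm_mul, mul_pow]
  have hT : ∑ x : ι × ι, ∑ y : ι × ι, p x.1 * q x.2 * (p y.1 * q y.2) *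
      star (p x.1 * q y.2 * (p y.1 * q x.2)) =
        ((∑ x : ι × ι, ‖p x.1 * q x.2‖ ^ 2 : ℝ) : ℂ) ^ 2 := by
    push_cast
    rw [sq, Finset.sum_mul_sum]
    refine Finset.sum_congr rfl fun x _ => Finset.sum_congr rfl fun y _ => ?_
    rw [← Complex.mul_conj', ← Complex.mul_conj']
    simp only [star_mul', Complex.star_def, map_mul]
    ring
  simp only [hT, hS] at h
  have h2 : (2 : ℝ) ≤ Fintype.card ι := by exact_mod_cast hι
  have hr : ∫ V, ‖entryForm (fun x => p x.1 * q x.2) V‖ ^ 4 ∂ν =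
      2 * ((∑ a, ‖p a‖ ^ 2) * ∑ b, ‖q b‖ ^ 2) ^ 2 / ((Fintype.card ι : ℝ) ^ 2 - 1) -
        2 * ((∑ a, ‖p a‖ ^ 2) * ∑ b, ‖q b‖ ^ 2) ^ 2 /
          (Fintype.card ι * ((Fintype.card ι : ℝ) ^ 2 - 1)) := by
    exact_mod_cast h
  rw [hr]
  have h3 : (Fintype.card ι : ℝ) ≠ 0 := by linarith
  have h4 : (Fintype.card ι : ℝ) + 1 ≠ 0 := by linarith
  have h5 : (Fintype.card ι : ℝ) ^ 2 - 1 ≠ 0 := by nlinarith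
  field_simp
  ring

theorem integral_norm_entryForm_pow_four_le {ν : Measure (UGroup ι)}
    [IsProbabilityMeasure ν] (hι : 2 ≤ Fintype.card ι)
    (hν : ∀ a b c d, entryMoment ν a b c d = weingartenTwo a b c d) (v : ι × ι → ℂ) :
    ∫ V, ‖entryForm v V‖ ^ 4 ∂ν ≤
      2 / ((Fintype.card ι : ℝ) ^ 2 - 1) * (∑ x, ‖v x‖ ^ 2) ^ 2 := by
  have h := integral_norm_entryForm_pow_four hν v
  -- The subtracted term is a sum of squares: the squared Frobenius norm of the Gram matrix of `v`.
  have hT : ∑ x : ι × ι, ∑ y : ι × ι, v x * v y * star (v (x.1, y.2) * v (y.1, x.2)) =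
      ((∑ b, ∑ b', ‖∑ a, v (a, b) * star (v (a, b'))‖ ^ 2 : ℝ) : ℂ) := by
    push_cast
    simp only [← Complex.mul_conj']
    simp only [Fintype.sum_prod_type]
    rw [Finset.sum_comm]
    refine Finset.sum_congr rfl fun b _ => ?_
    simp only [map_sum, Finset.sum_mul_sum]
    rw [Finset.sum_congr rfl fun a _ => Finset.sum_comm, Finset.sum_comm]
    refine Finset.sum_congr rfl fun b' _ => Finset.sum_congr rfl fun a _ =>
      Finset.sum_congr rfl fun a' _ => ?_
    simp only [star_mul', Complex.star_def, map_mul, Complex.conj_conj]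
    ring
  rw [hT] at h
  have hr : ∫ V, ‖entryForm v V‖ ^ 4 ∂ν =
      2 * (∑ x, ‖v x‖ ^ 2) ^ 2 / ((Fintype.card ι : ℝ) ^ 2 - 1) -
        2 * (∑ b, ∑ b', ‖∑ a, v (a, b) * star (v (a, b'))‖ ^ 2) /
          (Fintype.card ι * ((Fintype.card ι : ℝ) ^ 2 - 1)) := by
    exact_mod_cast h
  have h2 : (2 : ℝ) ≤ Fintype.card ι := by exact_mod_cast hι
  have h5 : 0 < (Fintype.card ι : ℝ) ^ 2 - 1 := by nlinarith
  have h6 : 0 ≤ 2 * (∑ b, ∑ b', ‖∑ a, v (a, b) * star (v (a, b'))‖ ^ 2) /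
      (Fintype.card ι * ((Fintype.card ι : ℝ) ^ 2 - 1)) := by positivity
  rw [hr, div_mul_eq_mul_div]
  linarith

end Moments

/-! ### Second moments of sums and tensorization -/

section Tensor

theorem integral_mul_le_of_integral_sq_le {K : Type*} [TopologicalSpace K] [CompactSpace K]
    [MeasurableSpace K] [BorelSpace K] {ν : Measure K} [IsFiniteMeasure ν] {f g : K → ℝ}
    (hf : Continuous f) (hg : Continuous g) {r s : ℝ} (hr : 0 ≤ r) (hs : 0 ≤ s)
    (hfr : ∫ x, f x ^ 2 ∂ν ≤ r ^ 2) (hgs : ∫ x, g x ^ 2 ∂ν ≤ s ^ 2) :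
    ∫ x, f x * g x ∂ν ≤ r * s := by
  have hff : Integrable (fun x => f x ^ 2) ν := integrable_of_continuous (hf.pow 2)
  have hgg : Integrable (fun x => g x ^ 2) ν := integrable_of_continuous (hg.pow 2)
  have hfg : Integrable (fun x => f x * g x) ν := integrable_of_continuous (hf.mul hg)
  have hf0 : 0 ≤ ∫ x, f x ^ 2 ∂ν := integral_nonneg fun _ => sq_nonneg _
  have hg0 : 0 ≤ ∫ x, g x ^ 2 ∂ν := integral_nonneg fun _ => sq_nonneg _
  -- The discriminant of the nonnegative quadratic `t ↦ ∫ (t f + g)²`.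
  have hquad : ∀ t : ℝ, 0 ≤ (∫ x, f x ^ 2 ∂ν) * (t * t) + (2 * ∫ x, f x * g x ∂ν) * t +
      ∫ x, g x ^ 2 ∂ν := by
    intro t
    have h : ∫ x, (t * f x + g x) ^ 2 ∂ν = (∫ x, f x ^ 2 ∂ν) * (t * t) +
        (2 * ∫ x, f x * g x ∂ν) * t + ∫ x, g x ^ 2 ∂ν := by
      have e : ∀ x, (t * f x + g x) ^ 2 = (t * t) * f x ^ 2 + (2 * t) * (f x * g x) + g x ^ 2 :=
        fun x => by ring
      have hadd : Integrable (fun x => (t * t) * f x ^ 2 + (2 * t) * (f x * g x)) ν :=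
        (hff.const_mul _).add (hfg.const_mul _)
      simp only [e]
      rw [integral_add hadd hgg, integral_add (hff.const_mul _) (hfg.const_mul _),
        integral_const_mul, integral_const_mul]
      ring
    rw [← h]
    exact integral_nonneg fun _ => sq_nonneg _
  have hd := discrim_le_zero hquad
  rw [discrim] at hd
  have hmul : (∫ x, f x ^ 2 ∂ν) * ∫ x, g x ^ 2 ∂ν ≤ r ^ 2 * s ^ 2 :=
    mul_le_mul hfr hgs hg0 (sq_nonneg r)
  exact le_of_sq_le_sq (by nlinarith) (mul_nonneg hr hs)

/-- Minkowski's inequality in `L²` for a finite sum, with bounds on the norms. -/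
theorem integral_sum_sq_le {K : Type*} [TopologicalSpace K] [CompactSpace K]
    [MeasurableSpace K] [BorelSpace K] {ν : Measure K} [IsFiniteMeasure ν] {π : Type*} [Fintype π]
    {f : π → K → ℝ} (hf : ∀ p, Continuous (f p)) {s : π → ℝ} (hs : ∀ p, 0 ≤ s p)
    (h : ∀ p, ∫ x, f p x ^ 2 ∂ν ≤ s p ^ 2) : ∫ x, (∑ p, f p x) ^ 2 ∂ν ≤ (∑ p, s p) ^ 2 := by
  have hint : ∀ p q, Integrable (fun x => f p x * f q x) ν := fun p q =>
    integrable_of_continuous ((hf p).mul (hf q))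
  simp only [sq (∑ p, _), Finset.sum_mul_sum]
  rw [integral_finsetSum _ fun p _ => integrable_finsetSum _ fun q _ => hint p q]
  refine Finset.sum_le_sum fun p _ => ?_
  rw [integral_finsetSum _ fun q _ => hint p q]
  exact Finset.sum_le_sum fun q _ =>
    integral_mul_le_of_integral_sq_le (hf p) (hf q) (hs p) (hs q) (h p) (h q)

variable {ι : Type} [Fintype ι] [DecidableEq ι]

/-- The multilinear form with coefficients `N` in the entries of `κ` unitaries; the index `x k` is
the row and column of the entry of the `k`-th unitary. -/
def tensorForm {κ : ℕ} (N : (Fin κ → ι × ι) → ℂ) (g : Fin κ → UGroup ι) : ℂ :=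
  ∑ x, N x * ∏ k, (g k).1 (x k).1 (x k).2

theorem continuous_tensorForm {κ : ℕ} (N : (Fin κ → ι × ι) → ℂ) : Continuous (tensorForm N) :=
  continuous_finsetSum _ fun _ _ => continuous_const.mul
    (continuous_finsetProd _ fun k _ => (continuous_entry _ _).comp (continuous_apply k))

theorem sum_fin_cons {α : Type*} [Fintype α] {M : Type*} [AddCommMonoid M] {κ : ℕ}
    (f : (Fin (κ + 1) → α) → M) : ∑ x, f x = ∑ j, ∑ y : Fin κ → α, f (Fin.cons j y) := by
  rw [← (Fin.consEquiv fun _ => α).sum_comp f, Fintype.sum_prod_type]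
  rfl

theorem tensorForm_cons {κ : ℕ} (N : (Fin (κ + 1) → ι × ι) → ℂ) (V : UGroup ι)
    (g : Fin κ → UGroup ι) : tensorForm N (Fin.cons V g) =
      entryForm (fun j => tensorForm (fun y => N (Fin.cons j y)) g) V := by
  simp only [tensorForm, entryForm, sum_fin_cons, Fin.prod_univ_succ, Fin.cons_zero, Fin.cons_succ,
    Finset.sum_mul]
  refine Finset.sum_congr rfl fun j _ => Finset.sum_congr rfl fun y _ => ?_
  ring

/-- Fourth moment bounds for the linear forms in independent unitaries multiply, one unitary being
integrated out at a time. -/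
theorem integral_pi_sum_norm_tensorForm_le {c : ℝ} (hc : 0 ≤ c) {κ : ℕ}
    (ν : Fin κ → Measure (UGroup ι)) [∀ k, IsProbabilityMeasure (ν k)]
    (hν : ∀ k (v : ι × ι → ℂ), ∫ V, ‖entryForm v V‖ ^ 4 ∂ν k ≤ c * (∑ x, ‖v x‖ ^ 2) ^ 2)
    {π : Type} [Fintype π] (N : π → (Fin κ → ι × ι) → ℂ) :
    ∫ g, (∑ p, ‖tensorForm (N p) g‖ ^ 2) ^ 2 ∂Measure.pi ν ≤
      c ^ κ * (∑ p, ∑ x, ‖N p x‖ ^ 2) ^ 2 := by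
  induction κ generalizing π with
  | zero => simp [tensorForm]
  | succ κ ih =>
    have hmp := (measurePreserving_piFinSuccAbove ν 0).symm
    rw [← hmp.integral_comp']
    have hcons : ∀ z : UGroup ι × (Fin κ → UGroup ι),
        (MeasurableEquiv.piFinSuccAbove (fun _ : Fin (κ + 1) => UGroup ι) 0).symm z =
          (Fin.cons z.1 z.2 : Fin (κ + 1) → UGroup ι) := fun z => Fin.insertNth_zero' z.1 z.2
    simp only [hcons, tensorForm_cons]
    have hcont : Continuous fun z : UGroup ι × (Fin κ → UGroup ι) =>
        (∑ p, ‖entryForm (fun j => tensorForm (fun y => N p (Fin.cons j y)) z.2) z.1‖ ^ 2) ^ 2 := by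
      refine (continuous_finsetSum _ fun p _ => Continuous.pow (Continuous.norm ?_) 2).pow 2
      exact continuous_finsetSum _ fun x _ => ((continuous_tensorForm _).comp continuous_snd).mul
        ((continuous_entry _ _).comp continuous_fst)
    rw [integral_prod_symm _ (integrable_of_continuous hcont)]
    -- For fixed other unitaries, each form is linear in the first unitary.
    have hinner : ∀ u : Fin κ → UGroup ι, ∫ V,
        (∑ p, ‖entryForm (fun j => tensorForm (fun y => N p (Fin.cons j y)) u) V‖ ^ 2) ^ 2 ∂ν 0 ≤
        c * (∑ q : π × (ι × ι), ‖tensorForm (fun y => N q.1 (Fin.cons q.2 y)) u‖ ^ 2) ^ 2 := by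
      intro u
      have h := integral_sum_sq_le (ν := ν 0)
        (f := fun p V => ‖entryForm (fun j => tensorForm (fun y => N p (Fin.cons j y)) u) V‖ ^ 2)
        (fun p => (continuous_entryForm _).norm.pow 2)
        (s := fun p => √c * ∑ j, ‖tensorForm (fun y => N p (Fin.cons j y)) u‖ ^ 2)
        (fun _ => by positivity) (fun p => ?_)
      · refine h.trans_eq ?_
        rw [← Finset.mul_sum, mul_pow, Real.sq_sqrt hc, Fintype.sum_prod_type]
      · simp only [← pow_mul, mul_pow _ _ 2, Real.sq_sqrt hc]
        exact hν 0 _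
    -- The coefficients of these linear forms are again forms of the kind considered, in one
    -- unitary less, with the index of the integrated entry as an additional parameter.
    have hle := ih (fun k => ν k.succ) (fun k => hν k.succ)
      (fun (q : π × (ι × ι)) y => N q.1 (Fin.cons q.2 y))
    have hcont2 : Continuous fun u : Fin κ → UGroup ι =>
        c * (∑ q : π × (ι × ι), ‖tensorForm (fun y => N q.1 (Fin.cons q.2 y)) u‖ ^ 2) ^ 2 :=
      continuous_const.mul ((continuous_finsetSum _ fun q _ =>
        (continuous_tensorForm _).norm.pow 2).pow 2)
    calc _ ≤ ∫ u, c * (∑ q : π × (ι × ι),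
          ‖tensorForm (fun y => N q.1 (Fin.cons q.2 y)) u‖ ^ 2) ^ 2
            ∂Measure.pi fun k => ν k.succ := by
          refine integral_mono ?_ (integrable_of_continuous hcont2) hinner
          exact (integrable_of_continuous hcont).integral_prod_right
      _ ≤ c * (c ^ κ * (∑ q : π × (ι × ι), ∑ y, ‖N q.1 (Fin.cons q.2 y)‖ ^ 2) ^ 2) := by
          rw [integral_const_mul]
          exact mul_le_mul_of_nonneg_left hle hc
      _ = _ := by
          rw [Fintype.sum_prod_type]
          simp only [sum_fin_cons fun x => ‖N _ x‖ ^ 2]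
          ring

end Tensor

/-! ### Overlaps of states -/

section Overlap

variable {ι : Type} [Fintype ι] [DecidableEq ι]

/-- The overlap `Tr[V ρ V† σ]`. -/
noncomputable def overlap (ρ σ : Matrix ι ι ℂ) (V : UGroup ι) : ℝ :=
  (Matrix.trace (V.1 * ρ * V.1.conjTranspose * σ)).re

theorem continuous_overlap_comp {K : Type*} [TopologicalSpace K] {ρ σ : K → Matrix ι ι ℂ}
    {V : K → UGroup ι} (hρ : Continuous ρ) (hσ : Continuous σ) (hV : Continuous V) :
    Continuous fun x => overlap (ρ x) (σ x) (V x) := by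
  have hV' : Continuous fun x => (V x).1 := continuous_subtype_val.comp hV
  exact Complex.continuous_re.comp
    ((((hV'.matrix_mul hρ).matrix_mul hV'.matrix_conjTranspose).matrix_mul hσ).matrix_trace)

theorem IsDensity.conj {ρ : Matrix ι ι ℂ} (h : IsDensity ρ) (V : UGroup ι) :
    IsDensity (V.1 * ρ * V.1.conjTranspose) := by
  refine ⟨h.1.mul_mul_conjTranspose_same _, ?_⟩
  rw [Matrix.trace_mul_comm, ← Matrix.mul_assoc]
  have : V.1.conjTranspose * V.1 = 1 := Matrix.mem_unitaryGroup_iff'.mp V.2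
  rw [this, one_mul, h.2]

/-- A density operator is a finite sum of operators `|ψ_i⟩⟨ψ_i|` with `∑ ‖ψ_i‖² = 1`. -/
theorem IsDensity.exists_eq_sum {ι : Type} [Fintype ι] {ρ : Matrix ι ι ℂ} (h : IsDensity ρ) :
    ∃ (r : ℕ) (ψ : Fin r → ι → ℂ), ρ = ∑ i, Matrix.vecMulVec (ψ i) (star (ψ i)) ∧
      ∑ i, ∑ a, ‖ψ i a‖ ^ 2 = 1 := by
  obtain ⟨r, ψ, rfl⟩ := Matrix.posSemidef_iff_eq_sum_vecMulVec.mp h.1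
  refine ⟨r, ψ, rfl, ?_⟩
  have ht := h.2
  rw [Matrix.trace_sum] at ht
  simp only [Matrix.trace, Matrix.diag_apply, Matrix.vecMulVec_apply,
    Pi.star_apply, Complex.star_def, Complex.mul_conj'] at ht
  exact_mod_cast ht

/-- The overlap of two ensembles of pure states is the sum of the squared moduli of the transition
amplitudes `⟨φ_j|V|ψ_i⟩`. -/
theorem overlap_sum_vecMulVec {π π' : Type*} [Fintype π] [Fintype π'] (ψ : π → ι → ℂ)
    (φ : π' → ι → ℂ) (V : UGroup ι) :
    overlap (∑ i, Matrix.vecMulVec (ψ i) (star (ψ i)))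
        (∑ j, Matrix.vecMulVec (φ j) (star (φ j))) V =
      ∑ p : π × π', ‖entryForm (fun x => star (φ p.2 x.1) * ψ p.1 x.2) V‖ ^ 2 := by
  have hterm : ∀ i j, Matrix.trace (V.1 * Matrix.vecMulVec (ψ i) (star (ψ i)) * V.1.conjTranspose *
      Matrix.vecMulVec (φ j) (star (φ j))) =
      ((‖entryForm (fun x => star (φ j x.1) * ψ i x.2) V‖ ^ 2 : ℝ) : ℂ) := by
    intro i j
    have he : entryForm (fun x => star (φ j x.1) * ψ i x.2) V =
        star (φ j) ⬝ᵥ (V.1.mulVec (ψ i)) := by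
      simp only [entryForm, dotProduct, Matrix.mulVec, Finset.mul_sum, Fintype.sum_prod_type,
        Pi.star_apply]
      exact Finset.sum_congr rfl fun a _ => Finset.sum_congr rfl fun b _ => by ring
    have hconj : V.1 * Matrix.vecMulVec (ψ i) (star (ψ i)) * V.1.conjTranspose =
        Matrix.vecMulVec (V.1.mulVec (ψ i)) (star (V.1.mulVec (ψ i))) := by
      rw [Matrix.mul_vecMulVec, Matrix.vecMulVec_mul, Matrix.star_mulVec]
    rw [he, hconj]
    push_cast
    rw [← Complex.mul_conj', ← Complex.star_def, ← Matrix.star_dotProduct_star, star_star]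
    simp only [Matrix.trace, Matrix.diag_apply, Matrix.mul_apply, Matrix.vecMulVec_apply,
      dotProduct, Finset.sum_mul_sum, Pi.star_apply]
    refine Finset.sum_congr rfl fun a _ => Finset.sum_congr rfl fun b _ => ?_
    ring
  simp only [overlap, Matrix.mul_sum, Matrix.sum_mul, Matrix.trace_sum, hterm, Complex.re_sum,
    Complex.ofReal_re, Fintype.sum_prod_type]
  rw [Finset.sum_comm]

theorem sum_norm_sq_product {ι : Type*} [Fintype ι] {π π' : Type*} [Fintype π] [Fintype π']
    (ψ : π → ι → ℂ) (φ : π' → ι → ℂ) :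
    ∑ p : π × π', ∑ x : ι × ι, ‖star (φ p.2 x.1) * ψ p.1 x.2‖ ^ 2 =
      (∑ j, ∑ a, ‖φ j a‖ ^ 2) * ∑ i, ∑ a, ‖ψ i a‖ ^ 2 := by
  simp only [Fintype.sum_prod_type, norm_mul, norm_star, mul_pow]
  simp only [← Finset.mul_sum, ← Finset.sum_mul]

/-- Stated for a random unitary `w` on any compact probability space, so as to cover both a design
on the whole register and a layer of independent blocks. -/
theorem integral_overlap_of_entry_moments {K : Type*} [TopologicalSpace K] [CompactSpace K]
    [MeasurableSpace K] [BorelSpace K] {ν : Measure K} [IsFiniteMeasure ν] {w : K → UGroup ι}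
    (hw : Continuous w)
    (h : ∀ a b c d, ∫ x, (w x).1 a b * star ((w x).1 c d) ∂ν =
      (if (c, d) = (a, b) then 1 else 0) / Fintype.card ι)
    {ρ σ : Matrix ι ι ℂ} (hρ : IsDensity ρ) (hσ : IsDensity σ) :
    ∫ x, overlap ρ σ (w x) ∂ν = 1 / Fintype.card ι := by
  have hexp : ∀ V : UGroup ι, Matrix.trace (V.1 * ρ * V.1.conjTranspose * σ) =
      ∑ x : ι × ι, ∑ y : ι × ι, (ρ x.2 y.2 * σ y.1 x.1) * (V.1 x.1 x.2 * star (V.1 y.1 y.2)) := by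
    intro V
    simp only [Matrix.trace, Matrix.diag_apply, Matrix.mul_apply, Finset.sum_mul,
      Fintype.sum_prod_type, Matrix.conjTranspose_apply]
    refine Finset.sum_congr rfl fun a _ => ?_
    rw [Finset.sum_comm (s := Finset.univ (α := ι)) (t := Finset.univ (α := ι))
      (f := fun b c => ∑ d, ρ b d * σ c a * (V.1 a b * star (V.1 c d)))]
    refine Finset.sum_congr rfl fun c _ => ?_
    rw [Finset.sum_comm]
    refine Finset.sum_congr rfl fun b _ => Finset.sum_congr rfl fun d _ => ?_
    ring
  have hint : ∀ x y : ι × ι, Integrable (fun k => (ρ x.2 y.2 * σ y.1 x.1) *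
      ((w k).1 x.1 x.2 * star ((w k).1 y.1 y.2))) ν := fun x y =>
    integrable_of_continuous (continuous_const.mul (((continuous_entry _ _).comp hw).mul
      ((continuous_entry _ _).comp hw).star))
  have htr : ∫ k, Matrix.trace ((w k).1 * ρ * (w k).1.conjTranspose * σ) ∂ν =
      1 / Fintype.card ι := by
    simp only [hexp]
    rw [integral_finsetSum _ fun x _ => integrable_finsetSum _ fun y _ => hint x y]
    have hin : ∀ x : ι × ι, ∫ k, ∑ y : ι × ι, (ρ x.2 y.2 * σ y.1 x.1) *
        ((w k).1 x.1 x.2 * star ((w k).1 y.1 y.2)) ∂ν =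
        ρ x.2 x.2 * σ x.1 x.1 * (1 / Fintype.card ι) := by
      intro x
      rw [integral_finsetSum _ fun y _ => hint x y, Finset.sum_eq_single x]
      · rw [integral_const_mul, h, if_pos rfl]
      · intro y _ hy
        rw [integral_const_mul, h, if_neg hy, zero_div, mul_zero]
      · simp
    have hρ1 : ∑ i, ρ i i = 1 := hρ.2
    have hσ1 : ∑ i, σ i i = 1 := hσ.2
    rw [Finset.sum_congr rfl fun x _ => hin x, ← Finset.sum_mul, Fintype.sum_prod_type,
      Finset.sum_comm]
    simp only [← Finset.mul_sum, hσ1, mul_one, hρ1, one_mul]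
  have hcont : Continuous fun k => Matrix.trace ((w k).1 * ρ * (w k).1.conjTranspose * σ) := by
    have hw' : Continuous fun k => (w k).1 := continuous_subtype_val.comp hw
    exact (((hw'.matrix_mul continuous_const).matrix_mul hw'.matrix_conjTranspose).matrix_mul
      continuous_const).matrix_trace
  have hre := integral_re (𝕜 := ℂ) (integrable_of_continuous (ν := ν) hcont)
  simp only [htr, RCLike.re_to_complex] at hre
  refine hre.trans ?_
  rw [one_div, one_div, ← Complex.ofReal_natCast, ← Complex.ofReal_inv, Complex.ofReal_re]

theorem integral_overlap_sq_of_isPure {ν : Measure (UGroup ι)} [IsProbabilityMeasure ν]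
    (hι : 2 ≤ Fintype.card ι) (hν : ∀ a b c d, entryMoment ν a b c d = weingartenTwo a b c d)
    {ρ σ : Matrix ι ι ℂ} (hρ : IsPure ρ) (hσ : IsPure σ) :
    ∫ V, overlap ρ σ V ^ 2 ∂ν = 2 / (Fintype.card ι * (Fintype.card ι + 1)) := by
  obtain ⟨ψ, hψ, rfl⟩ := hρ
  obtain ⟨φ, hφ, rfl⟩ := hσ
  have hnorm : ∀ χ : ι → ℂ, star χ ⬝ᵥ χ = 1 → ∑ a, ‖χ a‖ ^ 2 = 1 := by
    intro χ hχ
    simp only [dotProduct, Pi.star_apply, Complex.star_def, Complex.conj_mul'] at hχ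
    exact_mod_cast hχ
  have ho : ∀ V : UGroup ι, overlap (Matrix.vecMulVec ψ (star ψ)) (Matrix.vecMulVec φ (star φ)) V =
      ‖entryForm (fun x => star (φ x.1) * ψ x.2) V‖ ^ 2 := by
    intro V
    simpa using overlap_sum_vecMulVec (fun _ : Unit => ψ) (fun _ : Unit => φ) V
  simp only [ho, ← pow_mul]
  have h := integral_norm_entryForm_pow_four_of_product hι hν (fun a => star (φ a)) ψ
  simp only [norm_star, hnorm ψ hψ, hnorm φ hφ, one_pow, mul_one] at h
  exact h

/-- Mixed states have at most the second moment of pure states, by convexity of the `L²` norm. -/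
theorem integral_overlap_sq_le {ν : Measure (UGroup ι)} [IsProbabilityMeasure ν]
    (hι : 2 ≤ Fintype.card ι) (hν : ∀ a b c d, entryMoment ν a b c d = weingartenTwo a b c d)
    {ρ σ : Matrix ι ι ℂ} (hρ : IsDensity ρ) (hσ : IsDensity σ) :
    ∫ V, overlap ρ σ V ^ 2 ∂ν ≤ 2 / (Fintype.card ι * (Fintype.card ι + 1)) := by
  obtain ⟨r, ψ, rfl, hψ⟩ := hρ.exists_eq_sum
  obtain ⟨s, φ, rfl, hφ⟩ := hσ.exists_eq_sum
  have hc : (0 : ℝ) ≤ 2 / (Fintype.card ι * (Fintype.card ι + 1)) := by positivity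
  simp only [overlap_sum_vecMulVec]
  refine (integral_sum_sq_le
    (f := fun p V => ‖entryForm (fun x => star (φ p.2 x.1) * ψ p.1 x.2) V‖ ^ 2)
    (fun p => (continuous_entryForm _).norm.pow 2)
    (s := fun p : Fin r × Fin s => √(2 / (Fintype.card ι * (Fintype.card ι + 1))) *
      ((∑ a, ‖φ p.2 a‖ ^ 2) * ∑ b, ‖ψ p.1 b‖ ^ 2)) (fun _ => by positivity) fun p => ?_).trans_eq ?_
  · have h := integral_norm_entryForm_pow_four_of_product hι hν (fun a => star (φ p.2 a)) (ψ p.1)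
    simp only [norm_star] at h
    simp only [← pow_mul, mul_pow _ _ 2, Real.sq_sqrt hc] at h ⊢
    exact h.le
  · rw [← Finset.mul_sum, mul_pow, Real.sq_sqrt hc, Fintype.sum_prod_type]
    simp only [← Finset.sum_mul, hψ, hφ, one_mul, one_pow, mul_one]

end Overlap

/-! ### Layers of independent blocks -/

section Layer

variable {n m κ L : ℕ}

theorem card_bits (n : ℕ) : Fintype.card (Bits n) = 2 ^ n := by simp

/-- Bit strings of the register as families of bit strings of the blocks. -/
def blockEquiv (e : Fin κ × Fin m ≃ Fin n) : Bits n ≃ (Fin κ → Bits m) :=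
  (e.symm.arrowCongr (Equiv.refl (Fin 2))).trans (Equiv.curry _ _ _)

theorem layer_apply (e : Fin κ × Fin m ≃ Fin n) (g : Fin κ → UGroup (Bits m)) (a b : Bits n) :
    (layer e g).1 a b = ∏ k, (g k).1 (blockEquiv e a k) (blockEquiv e b k) := rfl

/-- Pairs of bit strings of the register as families of pairs of bit strings of the blocks. -/
def blockPairEquiv (e : Fin κ × Fin m ≃ Fin n) :
    (Fin κ → Bits m × Bits m) ≃ Bits n × Bits n :=
  (Equiv.arrowProdEquivProdArrow _ _ _).trans
    ((blockEquiv e).symm.prodCongr (blockEquiv e).symm)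

theorem entryForm_layer (e : Fin κ × Fin m ≃ Fin n) (v : Bits n × Bits n → ℂ)
    (g : Fin κ → UGroup (Bits m)) :
    entryForm v (layer e g) = tensorForm (fun x => v (blockPairEquiv e x)) g := by
  rw [entryForm, tensorForm, ← (blockPairEquiv e).sum_comp]
  refine Finset.sum_congr rfl fun x _ => ?_
  rw [layer_apply]
  simp only [blockPairEquiv, Equiv.trans_apply, Equiv.prodCongr_apply, Prod.map_fst, Prod.map_snd,
    Equiv.apply_symm_apply]
  rfl

theorem continuous_layer (e : Fin κ × Fin m ≃ Fin n) : Continuous (layer e) := by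
  refine Continuous.subtype_mk (continuous_matrix fun a b => ?_) _
  change Continuous fun g : Fin κ → UGroup (Bits m) =>
    ∏ k, (g k).1 (blockEquiv e a k) (blockEquiv e b k)
  exact continuous_finsetProd _ fun k _ =>
    (continuous_entry (blockEquiv e a k) (blockEquiv e b k)).comp (continuous_apply k)

theorem layeredCircuit_succ (layout : Fin (L + 1) → (Fin κ × Fin m ≃ Fin n))
    (W : Fin (L + 1) → Fin κ → UGroup (Bits m)) :
    layeredCircuit layout W = layer (layout (Fin.last L)) (W (Fin.last L)) *
      layeredCircuit (fun d => layout d.castSucc) (fun d => W d.castSucc) := by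
  simp only [layeredCircuit]
  rw [List.ofFn_succ', List.concat_eq_append, List.reverse_append, List.prod_append]
  simp

theorem continuous_layeredCircuit (layout : Fin L → (Fin κ × Fin m ≃ Fin n)) :
    Continuous (layeredCircuit layout) := by
  induction L with
  | zero => exact continuous_of_const fun _ _ => by simp [layeredCircuit]
  | succ L ih =>
    rw [funext (layeredCircuit_succ layout)]
    refine ((continuous_layer _).comp (continuous_apply _)).mul ((ih _).comp ?_)
    exact continuous_pi fun d => continuous_apply _

theorem integral_pi_layer_entry_mul_star (hn : n = m * κ) (e : Fin κ × Fin m ≃ Fin n)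
    (ν : Fin κ → Measure (UGroup (Bits m))) [∀ k, IsProbabilityMeasure (ν k)]
    (hν : ∀ k a b c d, ∫ V, V.1 a b * star (V.1 c d) ∂ν k =
      (if (c, d) = (a, b) then 1 else 0) / Fintype.card (Bits m)) (a b c d : Bits n) :
    ∫ g, (layer e g).1 a b * star ((layer e g).1 c d) ∂Measure.pi ν =
      (if (c, d) = (a, b) then 1 else 0) / Fintype.card (Bits n) := by
  simp only [layer_apply, star_prod, ← Finset.prod_mul_distrib]
  rw [integral_fintype_prod_eq_prod (fun k (V : UGroup (Bits m)) =>
    V.1 (blockEquiv e a k) (blockEquiv e b k) *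
      star (V.1 (blockEquiv e c k) (blockEquiv e d k)))]
  simp only [hν, Finset.prod_div_distrib]
  congr 1
  · by_cases h : (c, d) = (a, b)
    · obtain ⟨rfl, rfl⟩ := Prod.mk.inj h
      simp
    · rw [if_neg h]
      have : ∃ k, (blockEquiv e c k, blockEquiv e d k) ≠ (blockEquiv e a k, blockEquiv e b k) := by
        by_contra! hall
        refine h (Prod.ext ((blockEquiv e).injective (funext fun k => ?_))
          ((blockEquiv e).injective (funext fun k => ?_)))
        · exact (Prod.mk.inj (hall k)).1
        · exact (Prod.mk.inj (hall k)).2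
      obtain ⟨k, hk⟩ := this
      exact Finset.prod_eq_zero (Finset.mem_univ k) (if_neg hk)
  · simp [hn, pow_mul]

/-- Neither state has to be a product over the blocks: the amplitudes of the layer are multilinear
forms in the blocks whose squared coefficients add up to `Tr ρ Tr σ = 1`. -/
theorem integral_pi_overlap_layer_sq_le (hm : 1 ≤ m) (e : Fin κ × Fin m ≃ Fin n)
    (ν : Fin κ → Measure (UGroup (Bits m))) [∀ k, IsProbabilityMeasure (ν k)]
    (hν : ∀ k a b c d, entryMoment (ν k) a b c d = weingartenTwo a b c d)
    {ρ σ : Matrix (Bits n) (Bits n) ℂ} (hρ : IsDensity ρ) (hσ : IsDensity σ) :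
    ∫ g, overlap ρ σ (layer e g) ^ 2 ∂Measure.pi ν ≤
      (2 / ((Fintype.card (Bits m) : ℝ) ^ 2 - 1)) ^ κ := by
  have hcard : 2 ≤ Fintype.card (Bits m) := by
    rw [card_bits]
    exact Nat.le_self_pow (by omega) 2
  have h2 : (2 : ℝ) ≤ Fintype.card (Bits m) := by exact_mod_cast hcard
  have hc : 0 ≤ 2 / ((Fintype.card (Bits m) : ℝ) ^ 2 - 1) :=
    div_nonneg (by norm_num) (by nlinarith)
  obtain ⟨r, ψ, rfl, hψ⟩ := hρ.exists_eq_sum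
  obtain ⟨s, φ, rfl, hφ⟩ := hσ.exists_eq_sum
  simp only [overlap_sum_vecMulVec, entryForm_layer]
  refine (integral_pi_sum_norm_tensorForm_le hc ν
    (fun k v => integral_norm_entryForm_pow_four_le hcard (hν k) v) _).trans_eq ?_
  have hsum : ∑ p : Fin r × Fin s, ∑ x, ‖star (φ p.2 (blockPairEquiv e x).1) *
      ψ p.1 (blockPairEquiv e x).2‖ ^ 2 = 1 := by
    have h := sum_norm_sq_product ψ φ
    rw [hψ, hφ, one_mul] at h
    rw [← h]
    exact Finset.sum_congr rfl fun p _ =>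
      (blockPairEquiv e).sum_comp fun x => ‖star (φ p.2 x.1) * ψ p.1 x.2‖ ^ 2
  rw [hsum, one_pow, mul_one]

end Layer

/-! ### Independence and concentration -/

section Probability

variable {Ω : Type*} [MeasurableSpace Ω] {P : Measure Ω} [IsProbabilityMeasure P]

section Fubini

variable {A B : Type*} [TopologicalSpace A] [CompactSpace A] [MeasurableSpace A] [BorelSpace A]
  [TopologicalSpace B] [CompactSpace B] [MeasurableSpace B] [BorelSpace B]
  [SecondCountableTopology B]
  {X : Ω → A} {Y : Ω → B} {G : A × B → ℝ}

theorem integral_indep_eq_integral_integral (hX : Measurable X) (hY : Measurable Y)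
    (h : IndepFun X Y P) (hG : Continuous G) :
    ∫ ω, G (X ω, Y ω) ∂P = ∫ y, ∫ ω, G (X ω, y) ∂P ∂P.map Y := by
  have : IsProbabilityMeasure (P.map X) := Measure.isProbabilityMeasure_map hX.aemeasurable
  have : IsProbabilityMeasure (P.map Y) := Measure.isProbabilityMeasure_map hY.aemeasurable
  have hm := (indepFun_iff_map_prod_eq_prod_map_map hX.aemeasurable hY.aemeasurable).mp h
  rw [← integral_map (φ := fun ω => (X ω, Y ω)) (hX.prodMk hY).aemeasurable
    hG.measurable.aestronglyMeasurable, hm, integral_prod_symm _ (integrable_of_continuous hG)]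
  congr 1 with y
  exact integral_map hX.aemeasurable
    (hG.comp (Continuous.prodMk_left y)).measurable.aestronglyMeasurable

/-- An expectation may be computed with the independent variable `Y` held fixed. -/
theorem integral_indep_eq (hX : Measurable X) (hY : Measurable Y) (h : IndepFun X Y P)
    (hG : Continuous G) {c : ℝ} (hc : ∀ y, ∫ ω, G (X ω, y) ∂P = c) :
    ∫ ω, G (X ω, Y ω) ∂P = c := by
  have : IsProbabilityMeasure (P.map Y) := Measure.isProbabilityMeasure_map hY.aemeasurable
  rw [integral_indep_eq_integral_integral hX hY h hG]
  simp [hc]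

theorem integral_indep_le (hX : Measurable X) (hY : Measurable Y) (h : IndepFun X Y P)
    (hG : Continuous G) {c : ℝ} (hc : ∀ y, ∫ ω, G (X ω, y) ∂P ≤ c) :
    ∫ ω, G (X ω, Y ω) ∂P ≤ c := by
  have : IsProbabilityMeasure (P.map X) := Measure.isProbabilityMeasure_map hX.aemeasurable
  have : IsProbabilityMeasure (P.map Y) := Measure.isProbabilityMeasure_map hY.aemeasurable
  rw [integral_indep_eq_integral_integral hX hY h hG]
  have hint : Integrable (fun y => ∫ ω, G (X ω, y) ∂P) (P.map Y) := by
    have := (integrable_of_continuous (ν := (P.map X).prod (P.map Y)) hG).integral_prod_right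
    refine this.congr (Eventually.of_forall fun y => ?_)
    exact integral_map hX.aemeasurable
      (hG.comp (Continuous.prodMk_left y)).measurable.aestronglyMeasurable
  refine (integral_mono hint (integrable_const c) hc).trans_eq ?_
  simp

end Fubini

theorem memLp_two_of_continuous_comp {A : Type*} [TopologicalSpace A] [CompactSpace A]
    [MeasurableSpace A] [BorelSpace A] {X : Ω → A} (hX : Measurable X) {G : A → ℝ}
    (hG : Continuous G) : MemLp (fun ω => G (X ω)) 2 P := by
  obtain ⟨C, hC⟩ := (isCompact_range hG).isBounded.exists_norm_le
  exact MemLp.of_bound (hG.measurable.comp hX).aestronglyMeasurable C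
    (Eventually.of_forall fun ω => hC _ ⟨X ω, rfl⟩)

theorem real_abs_sub_ge_le_of_variance_le {k : Ω → ℝ} (hk : MemLp k 2 P) {μ v : ℝ}
    (hμ : ∫ ω, k ω ∂P = μ) (hv : variance k P ≤ v) {δ : ℝ} (hδ : 0 < δ) :
    P.real {ω | δ ≤ |k ω - μ|} ≤ v / δ ^ 2 := by
  have h := meas_ge_le_variance_div_sq hk hδ
  rw [hμ] at h
  refine (ENNReal.toReal_le_of_le_ofReal (by positivity [variance_nonneg k P]) h).trans ?_
  gcongr

theorem variance_eq_integral_sq_sub {k : Ω → ℝ} (hk : MemLp k 2 P) {μ : ℝ}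
    (hμ : ∫ ω, k ω ∂P = μ) : variance k P = ∫ ω, k ω ^ 2 ∂P - μ ^ 2 := by
  rw [variance_eq_sub hk, hμ]
  rfl

end Probability

/-! ### Moments of the quantum kernel -/

/-- The blocks of the last layer are jointly independent of the product of the earlier layers. -/
theorem indepFun_lastLayer_earlier {Ω : Type*} [MeasurableSpace Ω] {P : Measure Ω}
    {n m κ L : ℕ} {layout : Fin (L + 1) → (Fin κ × Fin m ≃ Fin n)}
    {W : Fin (L + 1) → Fin κ → Ω → UGroup (Bits m)} (hW : ∀ d k, Measurable (W d k))
    (hind : iIndepFun (fun (b : Fin (L + 1) × Fin κ) ω => W b.1 b.2 ω) P) :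
    IndepFun (fun ω k => W (Fin.last L) k ω)
      (fun ω => layeredCircuit (fun d => layout d.castSucc) fun d k => W d.castSucc k ω) P := by
  have h := hind.indepFun_finset (Finset.univ.filter fun b => b.1 = Fin.last L)
    (Finset.univ.filter fun b => b.1 ≠ Fin.last L)
    (Finset.disjoint_filter_filter_not _ _ _) (fun b => hW b.1 b.2)
  refine h.comp
    (φ := fun z k => z ⟨(Fin.last L, k), by simp⟩)
    (ψ := fun z => layeredCircuit (fun d => layout d.castSucc)
      fun d k => z ⟨(d.castSucc, k), by simp [Fin.castSucc_ne_last]⟩) ?_ ?_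
  · exact measurable_pi_lambda _ fun k => measurable_pi_apply _
  · refine (continuous_layeredCircuit _).measurable.comp ?_
    exact measurable_pi_lambda _ fun d => measurable_pi_lambda _ fun k => measurable_pi_apply _

theorem measurable_layeredCircuit {Ω : Type*} [MeasurableSpace Ω] {n m κ L : ℕ}
    {layout : Fin L → (Fin κ × Fin m ≃ Fin n)} {W : Fin L → Fin κ → Ω → UGroup (Bits m)}
    (hW : ∀ d k, Measurable (W d k)) :
    Measurable fun ω => layeredCircuit layout fun d k => W d k ω :=
  (continuous_layeredCircuit layout).measurable.comp
    (measurable_pi_lambda _ fun d => measurable_pi_lambda _ fun k => hW d k)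

theorem map_lastLayer {Ω : Type*} [MeasurableSpace Ω] {P : Measure Ω} {m κ L : ℕ}
    {W : Fin (L + 1) → Fin κ → Ω → UGroup (Bits m)}
    (hW : ∀ d k, Measurable (W d k))
    (hind : iIndepFun (fun (b : Fin (L + 1) × Fin κ) ω => W b.1 b.2 ω) P) :
    P.map (fun ω k => W (Fin.last L) k ω) =
    Measure.pi fun k => P.map (W (Fin.last L) k) := by
  have h := hind.precomp (g := fun k : Fin κ => (Fin.last L, k)) (Prod.mk_right_injective _)
  exact h.map_fun_eq_pi_map fun k => (hW _ k).aemeasurable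

/-- The pair of the last layer and the product of the earlier ones is independent of the other
unitary. -/
theorem indepFun_layers_other {Ω : Type*} [MeasurableSpace Ω] {P : Measure Ω}
    {n m κ L : ℕ} {layout : Fin (L + 1) → (Fin κ × Fin m ≃ Fin n)}
    {W : Fin (L + 1) → Fin κ → Ω → UGroup (Bits m)} {V' : Ω → UGroup (Bits n)}
    (hindV' : IndepFun (fun ω (b : Fin (L + 1) × Fin κ) => W b.1 b.2 ω) V' P) : IndepFun
    (fun ω => ((fun k => W (Fin.last L) k ω : Fin κ → UGroup (Bits m)),
      layeredCircuit (fun d => layout d.castSucc) fun d k => W d.castSucc k ω)) V' P := by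
  refine hindV'.comp (ψ := id) (φ := fun z => ((fun k => z (Fin.last L, k)),
    layeredCircuit (fun d => layout d.castSucc) fun d k => z (d.castSucc, k))) ?_ measurable_id
  refine Measurable.prodMk (measurable_pi_lambda _ fun k => measurable_pi_apply _) ?_
  refine (continuous_layeredCircuit _).measurable.comp ?_
  exact measurable_pi_lambda _ fun d => measurable_pi_lambda _ fun k => measurable_pi_apply _

section Kernel

variable {Ω : Type*} [MeasurableSpace Ω] {P : Measure Ω} [IsProbabilityMeasure P]

/-- The kernel value `Tr[V ρ V† V' ρ V'†]` of the pair of unitaries `(V, V')`. -/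
noncomputable def pairKernel {ι : Type} [Fintype ι] [DecidableEq ι] (ρ : Matrix ι ι ℂ)
    (V V' : UGroup ι) : ℝ :=
  overlap ρ (V'.1 * ρ * V'.1.conjTranspose) V

theorem quantumKernel_eq_pairKernel {ι : Type} [Fintype ι] [DecidableEq ι] {X Θ : Type*}
    (U : X → Θ → UGroup ι) (ρ : Matrix ι ι ℂ) (θ : Θ) (x x' : X) :
    quantumKernel U ρ θ x x' = pairKernel ρ (U x θ) (U x' θ) := rfl

theorem pairKernel_comm {ι : Type} [Fintype ι] [DecidableEq ι] (ρ : Matrix ι ι ℂ)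
    (V V' : UGroup ι) : pairKernel ρ V V' = pairKernel ρ V' V := by
  rw [pairKernel, pairKernel, overlap, overlap, Matrix.trace_mul_comm]

theorem pairKernel_mul {ι : Type} [Fintype ι] [DecidableEq ι] (ρ : Matrix ι ι ℂ)
    (V₁ V₂ V' : UGroup ι) : pairKernel ρ (V₁ * V₂) V' =
      overlap (V₂.1 * ρ * V₂.1.conjTranspose) (V'.1 * ρ * V'.1.conjTranspose) V₁ := by
  simp only [pairKernel, overlap, Submonoid.coe_mul, Matrix.conjTranspose_mul, Matrix.mul_assoc]

theorem continuous_conj_state {ι : Type} [Fintype ι] [DecidableEq ι] (ρ : Matrix ι ι ℂ) :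
    Continuous fun V : UGroup ι => V.1 * ρ * V.1.conjTranspose :=
  (continuous_subtype_val.matrix_mul continuous_const).matrix_mul
    continuous_subtype_val.matrix_conjTranspose

theorem continuous_pairKernel {ι : Type} [Fintype ι] [DecidableEq ι] (ρ : Matrix ι ι ℂ) :
    Continuous fun z : UGroup ι × UGroup ι => pairKernel ρ z.1 z.2 :=
  continuous_overlap_comp continuous_const ((continuous_conj_state ρ).comp continuous_snd)
    continuous_fst

theorem IsPure.conj {ι : Type} [Fintype ι] [DecidableEq ι] {ρ : Matrix ι ι ℂ} (h : IsPure ρ)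
    (V : UGroup ι) : IsPure (V.1 * ρ * V.1.conjTranspose) := by
  obtain ⟨ψ, hψ, rfl⟩ := h
  refine ⟨V.1.mulVec ψ, ?_, ?_⟩
  · have hV : V.1.conjTranspose * V.1 = 1 := Matrix.mem_unitaryGroup_iff'.mp V.2
    rw [Matrix.star_mulVec, Matrix.dotProduct_mulVec, Matrix.vecMul_vecMul, hV, Matrix.vecMul_one,
      hψ]
  · rw [Matrix.mul_vecMulVec, Matrix.vecMulVec_mul, Matrix.star_mulVec]

/-- The case of no qubits, where the Weingarten formula is not available. -/
theorem overlap_eq_one_of_subsingleton {ι : Type} [Fintype ι] [DecidableEq ι] [Subsingleton ι]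
    {ρ σ : Matrix ι ι ℂ} (hρ : IsDensity ρ) (hσ : IsDensity σ) (V : UGroup ι) :
    overlap ρ σ V = 1 := by
  have hone : ∀ {τ : Matrix ι ι ℂ}, IsDensity τ → τ = 1 := by
    intro τ hτ
    ext i j
    obtain rfl := Subsingleton.elim i j
    have h := hτ.2
    rw [Matrix.trace, Fintype.sum_subsingleton _ i] at h
    simpa using h
  have h := (hρ.conj V).2
  rw [overlap, hone hσ, mul_one, h, Complex.one_re]

variable {n : ℕ} {V V' : Ω → UGroup (Bits n)} {ρ : Matrix (Bits n) (Bits n) ℂ}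

theorem memLp_pairKernel (hV : Measurable V) (hV' : Measurable V') :
    MemLp (fun ω => pairKernel ρ (V ω) (V' ω)) 2 P :=
  memLp_two_of_continuous_comp (hV.prodMk hV') (continuous_pairKernel ρ)

theorem integral_pairKernel_of_isTDesign (hρ : IsDensity ρ) (hV : Measurable V)
    (hV' : Measurable V') (h : IndepFun V V' P) (hd : IsTDesign P 1 V) :
    ∫ ω, pairKernel ρ (V ω) (V' ω) ∂P = 1 / 2 ^ n := by
  have : IsProbabilityMeasure (P.map V) := Measure.isProbabilityMeasure_map hV.aemeasurable
  refine integral_indep_eq hV hV' h (continuous_pairKernel ρ) fun y => ?_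
  rw [← integral_map (φ := V) (f := fun x => pairKernel ρ x y) hV.aemeasurable
    ((continuous_pairKernel ρ).comp (Continuous.prodMk_left y)).measurable.aestronglyMeasurable]
  refine (integral_overlap_of_entry_moments continuous_id (hd.integral_entry_mul_star hV) hρ
    (hρ.conj y)).trans ?_
  simp

theorem integral_pairKernel_sq_le_of_isTDesign (hρ : IsDensity ρ) (hV : Measurable V)
    (hV' : Measurable V') (h : IndepFun V V' P) (hd : IsTDesign P 2 V) :
    ∫ ω, pairKernel ρ (V ω) (V' ω) ^ 2 ∂P ≤ 2 / (2 ^ n * (2 ^ n + 1)) := by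
  have : IsProbabilityMeasure (P.map V) := Measure.isProbabilityMeasure_map hV.aemeasurable
  refine integral_indep_le hV hV' h (G := fun z => pairKernel ρ z.1 z.2 ^ 2)
    ((continuous_pairKernel ρ).pow 2) fun y => ?_
  rcases Nat.eq_zero_or_pos n with rfl | hn
  · have h1 : ∀ x : UGroup (Bits 0), pairKernel ρ x y = 1 :=
      overlap_eq_one_of_subsingleton hρ (hρ.conj y)
    simp only [h1]
    norm_num
  · rw [← integral_map (φ := V) (f := fun x => pairKernel ρ x y ^ 2) hV.aemeasurable
      (((continuous_pairKernel ρ).pow 2).comp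
        (Continuous.prodMk_left y)).measurable.aestronglyMeasurable]
    have hcard : 2 ≤ Fintype.card (Bits n) := by
      rw [card_bits]
      exact Nat.le_self_pow (by omega) 2
    refine (integral_overlap_sq_le hcard (hd.entryMoment_eq hV hcard) hρ (hρ.conj y)).trans_eq ?_
    simp

theorem integral_pairKernel_sq_of_isTDesign_of_isPure (hρ : IsDensity ρ) (hp : IsPure ρ)
    (hV : Measurable V) (hV' : Measurable V') (h : IndepFun V V' P) (hd : IsTDesign P 2 V) :
    ∫ ω, pairKernel ρ (V ω) (V' ω) ^ 2 ∂P = 2 / (2 ^ n * (2 ^ n + 1)) := by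
  have : IsProbabilityMeasure (P.map V) := Measure.isProbabilityMeasure_map hV.aemeasurable
  refine integral_indep_eq hV hV' h (G := fun z => pairKernel ρ z.1 z.2 ^ 2)
    ((continuous_pairKernel ρ).pow 2) fun y => ?_
  rcases Nat.eq_zero_or_pos n with rfl | hn
  · have h1 : ∀ x : UGroup (Bits 0), pairKernel ρ x y = 1 :=
      overlap_eq_one_of_subsingleton hρ (hρ.conj y)
    simp only [h1]
    norm_num
  · rw [← integral_map (φ := V) (f := fun x => pairKernel ρ x y ^ 2) hV.aemeasurable
      (((continuous_pairKernel ρ).pow 2).comp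
        (Continuous.prodMk_left y)).measurable.aestronglyMeasurable]
    have hcard : 2 ≤ Fintype.card (Bits n) := by
      rw [card_bits]
      exact Nat.le_self_pow (by omega) 2
    refine (integral_overlap_sq_of_isPure hcard (hd.entryMoment_eq hV hcard) hp
      (hp.conj y)).trans ?_
    simp

variable {m κ L : ℕ} {layout : Fin (L + 1) → (Fin κ × Fin m ≃ Fin n)}
  {W : Fin (L + 1) → Fin κ → Ω → UGroup (Bits m)}

/-- The kernel value of a layered circuit, as a function of the last layer, the product of the
earlier layers, and the other unitary. -/
noncomputable def lastLayerKernel (e : Fin κ × Fin m ≃ Fin n) (ρ : Matrix (Bits n) (Bits n) ℂ)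
    (z : ((Fin κ → UGroup (Bits m)) × UGroup (Bits n)) × UGroup (Bits n)) : ℝ :=
  overlap (z.1.2.1 * ρ * z.1.2.1.conjTranspose) (z.2.1 * ρ * z.2.1.conjTranspose) (layer e z.1.1)

theorem continuous_lastLayerKernel (e : Fin κ × Fin m ≃ Fin n)
    (ρ : Matrix (Bits n) (Bits n) ℂ) : Continuous (lastLayerKernel e ρ) :=
  continuous_overlap_comp
    ((continuous_conj_state ρ).comp (continuous_snd.comp continuous_fst))
    ((continuous_conj_state ρ).comp continuous_snd)
    ((continuous_layer e).comp (continuous_fst.comp continuous_fst))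

theorem pairKernel_layeredCircuit (g : Fin (L + 1) → Fin κ → UGroup (Bits m))
    (y : UGroup (Bits n)) : pairKernel ρ (layeredCircuit layout g) y =
      lastLayerKernel (layout (Fin.last L)) ρ
        ((g (Fin.last L), layeredCircuit (fun d => layout d.castSucc) fun d => g d.castSucc),
          y) := by
  rw [layeredCircuit_succ, pairKernel_mul]
  rfl

theorem memLp_pairKernel_layeredCircuit
    (hW : ∀ d k, Measurable (W d k))
    (hV' : Measurable V') : MemLp (fun ω =>
    pairKernel ρ (layeredCircuit layout fun d k => W d k ω) (V' ω)) 2 P :=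
  memLp_pairKernel (measurable_layeredCircuit hW) hV'

theorem integral_pairKernel_layeredCircuit
    (hW : ∀ d k, Measurable (W d k))
    (hV' : Measurable V')
    (hind : iIndepFun (fun (b : Fin (L + 1) × Fin κ) ω => W b.1 b.2 ω) P)
    (hindV' : IndepFun (fun ω (b : Fin (L + 1) × Fin κ) => W b.1 b.2 ω) V' P)
    (hn : n = m * κ) (hρ : IsDensity ρ)
    (hd : ∀ k, IsTDesign P 1 (W (Fin.last L) k)) :
    ∫ ω, pairKernel ρ (layeredCircuit layout fun d k => W d k ω) (V' ω) ∂P = 1 / 2 ^ n := by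
  have hlast : Measurable fun ω k => W (Fin.last L) k ω := measurable_pi_lambda _ fun k => hW _ k
  have hearlier : Measurable fun ω =>
      layeredCircuit (fun d : Fin L => layout d.castSucc) fun d k => W d.castSucc k ω :=
    measurable_layeredCircuit fun (d : Fin L) k => hW d.castSucc k
  have hprob : ∀ k, IsProbabilityMeasure (P.map (W (Fin.last L) k)) := fun k =>
    Measure.isProbabilityMeasure_map (hW _ k).aemeasurable
  simp only [pairKernel_layeredCircuit]
  refine integral_indep_eq (hlast.prodMk hearlier) hV' (indepFun_layers_other hindV')
    (continuous_lastLayerKernel _ ρ) fun y => ?_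
  refine integral_indep_eq (G := fun z => lastLayerKernel (layout (Fin.last L)) ρ (z, y))
    hlast hearlier (indepFun_lastLayer_earlier hW hind)
    ((continuous_lastLayerKernel _ ρ).comp (Continuous.prodMk_left y)) fun x => ?_
  rw [← integral_map (φ := fun ω k => W (Fin.last L) k ω)
    (f := fun g => lastLayerKernel (layout (Fin.last L)) ρ ((g, x), y)) hlast.aemeasurable
    ((continuous_lastLayerKernel _ ρ).comp ((Continuous.prodMk_left y).comp
      (Continuous.prodMk_left x))).measurable.aestronglyMeasurable, map_lastLayer hW hind]
  refine (integral_overlap_of_entry_moments (continuous_layer _)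
    (integral_pi_layer_entry_mul_star hn _ _ fun k => (hd k).integral_entry_mul_star (hW _ k))
    (hρ.conj x) (hρ.conj y)).trans ?_
  simp

theorem integral_pairKernel_layeredCircuit_sq_le
    (hW : ∀ d k, Measurable (W d k))
    (hV' : Measurable V')
    (hind : iIndepFun (fun (b : Fin (L + 1) × Fin κ) ω => W b.1 b.2 ω) P)
    (hindV' : IndepFun (fun ω (b : Fin (L + 1) × Fin κ) => W b.1 b.2 ω) V' P)
    (hm : 1 ≤ m) (hρ : IsDensity ρ)
    (hd : ∀ k, IsTDesign P 2 (W (Fin.last L) k)) :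
    ∫ ω, pairKernel ρ (layeredCircuit layout fun d k => W d k ω) (V' ω) ^ 2 ∂P ≤
      (2 / (2 ^ (2 * m) - 1)) ^ κ := by
  have hlast : Measurable fun ω k => W (Fin.last L) k ω := measurable_pi_lambda _ fun k => hW _ k
  have hearlier : Measurable fun ω =>
      layeredCircuit (fun d : Fin L => layout d.castSucc) fun d k => W d.castSucc k ω :=
    measurable_layeredCircuit fun (d : Fin L) k => hW d.castSucc k
  have hprob : ∀ k, IsProbabilityMeasure (P.map (W (Fin.last L) k)) := fun k =>
    Measure.isProbabilityMeasure_map (hW _ k).aemeasurable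
  have hcard : 2 ≤ Fintype.card (Bits m) := by
    rw [card_bits]
    exact Nat.le_self_pow (by omega) 2
  simp only [pairKernel_layeredCircuit]
  refine integral_indep_le (G := fun z => lastLayerKernel (layout (Fin.last L)) ρ z ^ 2)
    (hlast.prodMk hearlier) hV' (indepFun_layers_other hindV')
    ((continuous_lastLayerKernel _ ρ).pow 2) fun y => ?_
  refine integral_indep_le (G := fun z => lastLayerKernel (layout (Fin.last L)) ρ (z, y) ^ 2)
    hlast hearlier (indepFun_lastLayer_earlier hW hind)
    (((continuous_lastLayerKernel _ ρ).comp (Continuous.prodMk_left y)).pow 2) fun x => ?_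
  rw [← integral_map (φ := fun ω k => W (Fin.last L) k ω)
    (f := fun g => lastLayerKernel (layout (Fin.last L)) ρ ((g, x), y) ^ 2) hlast.aemeasurable
    (((continuous_lastLayerKernel _ ρ).comp ((Continuous.prodMk_left y).comp
      (Continuous.prodMk_left x))).pow 2).measurable.aestronglyMeasurable, map_lastLayer hW hind]
  refine (integral_pi_overlap_layer_sq_le hm _ _
    (fun k => (hd k).entryMoment_eq (hW _ k) hcard) (hρ.conj x) (hρ.conj y)).trans_eq ?_
  simp [← pow_mul, mul_comm m 2]

end Kernel

/-! ### Size of the variance bounds -/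

theorem two_div_sub_sq (n : ℕ) :
    (2 : ℝ) / (2 ^ n * (2 ^ n + 1)) - (1 / 2 ^ n) ^ 2 =
      (2 ^ n - 1) / (2 ^ (2 * n) * (2 ^ n + 1)) := by
  have h : (2 : ℝ) ^ n ≠ 0 := by positivity
  have h' : (2 : ℝ) ^ n + 1 ≠ 0 := by positivity
  rw [mul_comm 2 n, pow_mul]
  field_simp
  ring

theorem design_bound_le (n : ℕ) :
    ((2 : ℝ) ^ n - 1) / (2 ^ (2 * n) * (2 ^ n + 1)) ≤ (1 / 4) ^ n := by
  have h : (0 : ℝ) < 2 ^ n := by positivity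
  have h4 : (2 : ℝ) ^ (2 * n) = 4 ^ n := by rw [pow_mul]; norm_num
  rw [h4, one_div_pow, div_le_div_iff₀ (by positivity) (by positivity)]
  nlinarith [show (0 : ℝ) < 4 ^ n by positivity]

theorem two_div_four_pow_sub_one_le (m : ℕ) (hm : 1 ≤ m) :
    (2 : ℝ) / (2 ^ (2 * m) - 1) ≤ (2 / 3) ^ m := by
  have h4 : (2 : ℝ) ^ (2 * m) = 4 ^ m := by rw [pow_mul]; norm_num
  have h1 : (4 : ℝ) ≤ 4 ^ m := le_self_pow₀ (by norm_num) (by omega)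
  have key : 2 * (3 : ℝ) ^ m ≤ 2 ^ m * (4 ^ m - 1) := by
    induction m, hm using Nat.le_induction with
    | base => norm_num
    | succ m hm ih =>
      have h1 : (4 : ℝ) ≤ 4 ^ m := le_self_pow₀ (by norm_num) (by omega)
      have h2 : (0 : ℝ) < 2 ^ m := by positivity
      have := ih (by rw [pow_mul]; norm_num) h1
      rw [pow_succ, pow_succ, pow_succ]
      nlinarith
  rw [h4, div_pow, div_le_div_iff₀ (by linarith) (by positivity)]
  exact key

theorem layer_bound_le (m κ : ℕ) (hm : 1 ≤ m) :
    (2 : ℝ) ^ κ / (2 ^ (2 * m) - 1) ^ κ - 1 / 2 ^ (2 * (m * κ)) ≤ (2 / 3) ^ (m * κ) := by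
  have h1 : (1 : ℝ) ≤ 2 ^ (2 * m) := one_le_pow₀ (by norm_num)
  have h := pow_le_pow_left₀ (div_nonneg (by norm_num) (by linarith))
    (two_div_four_pow_sub_one_le m hm) κ
  rw [div_pow, ← pow_mul] at h
  have : (0 : ℝ) < 1 / 2 ^ (2 * (m * κ)) := by positivity
  linarith

theorem layer_bound_eq (m κ : ℕ) (hm : 1 ≤ m) :
    (2 : ℝ) ^ κ / (2 ^ (2 * m) - 1) ^ κ - 1 / 2 ^ (2 * (m * κ)) =
      ((1 - 1 / 4 ^ m)⁻¹ ^ κ - 1 / 2 ^ κ) *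
        (2 : ℝ) ^ (-((m * κ : ℕ) : ℝ) * (2 - 1 / (m : ℝ))) := by
  have hm0 : (m : ℝ) ≠ 0 := by positivity
  have hexp : -((m * κ : ℕ) : ℝ) * (2 - 1 / (m : ℝ)) = (κ : ℝ) - ((2 * (m * κ) : ℕ) : ℝ) := by
    push_cast
    field_simp
    ring
  have h4 : (2 : ℝ) ^ (2 * m) = 4 ^ m := by rw [pow_mul]; norm_num
  have h1 : (4 : ℝ) ≤ 4 ^ m := le_self_pow₀ (by norm_num) (by omega)
  have h2 : (4 : ℝ) ^ m - 1 ≠ 0 := by linarith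
  have hinv : (1 - 1 / (4 : ℝ) ^ m)⁻¹ = 4 ^ m / (4 ^ m - 1) := by
    field_simp
  rw [hexp, Real.rpow_sub (by norm_num), Real.rpow_natCast, Real.rpow_natCast, hinv, ← mul_assoc 2,
    pow_mul 2 (2 * m) κ, h4, div_pow]
  field_simp

theorem tendsto_layer_bound_ratio (m κ : ℕ → ℕ) (hκ : Tendsto κ atTop atTop)
    (h : Tendsto (fun j => (κ j : ℝ) / 4 ^ m j) atTop (𝓝 0)) :
    Tendsto (fun j =>
      ((2 : ℝ) ^ κ j / (2 ^ (2 * m j) - 1) ^ κ j - 1 / 2 ^ (2 * (m j * κ j))) /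
      (2 : ℝ) ^ (-((m j * κ j : ℕ) : ℝ) * (2 - 1 / (m j : ℝ)))) atTop (𝓝 1) := by
  -- Small `κ / 4 ^ m` with `κ ≥ 1` forces `m ≥ 1`.
  have hm : ∀ᶠ j in atTop, 1 ≤ m j := by
    filter_upwards [hκ.eventually_ge_atTop 1, h.eventually_lt_const one_pos] with j h1 h2
    by_contra h0
    have h3 : m j = 0 := by omega
    have h4 : (1 : ℝ) ≤ κ j := by exact_mod_cast h1
    rw [h3, pow_zero, div_one] at h2
    linarith
  have hfirst : Tendsto (fun j => (1 - 1 / (4 : ℝ) ^ m j) ^ κ j) atTop (𝓝 1) := by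
    have hlow : Tendsto (fun j => 1 - (κ j : ℝ) / 4 ^ m j) atTop (𝓝 1) := by
      simpa using h.const_sub 1
    have hle : ∀ j, 1 / (4 : ℝ) ^ m j ≤ 1 := fun j => by
      rw [div_le_one (by positivity)]
      exact one_le_pow₀ (by norm_num)
    refine tendsto_of_tendsto_of_tendsto_of_le_of_le hlow tendsto_const_nhds (fun j => ?_)
      fun j => ?_
    · have hb := one_add_mul_le_pow (a := -(1 / (4 : ℝ) ^ m j)) (by linarith [hle j]) (κ j)
      calc 1 - (κ j : ℝ) / 4 ^ m j = 1 + (κ j : ℝ) * -(1 / (4 : ℝ) ^ m j) := by ring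
        _ ≤ _ := hb
    · exact pow_le_one₀ (by linarith [hle j])
        (by linarith [show 0 < 1 / (4 : ℝ) ^ m j by positivity])
  have hsecond : Tendsto (fun j => 1 / (2 : ℝ) ^ κ j) atTop (𝓝 0) := by
    have := (tendsto_pow_atTop_nhds_zero_of_lt_one (r := (1 / 2 : ℝ)) (by norm_num)
      (by norm_num)).comp hκ
    refine this.congr fun j => ?_
    simp
  have hlim : Tendsto (fun j => (1 - 1 / (4 : ℝ) ^ m j)⁻¹ ^ κ j - 1 / 2 ^ κ j) atTop (𝓝 1) := by
    have := (hfirst.inv₀ one_ne_zero).sub hsecond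
    simpa only [inv_pow, inv_one, sub_zero] using this
  refine hlim.congr' ?_
  filter_upwards [hm] with j hj
  rw [layer_bound_eq _ _ hj, mul_div_cancel_right₀]
  exact (Real.rpow_pos_of_pos two_pos _).ne'

/-! ### Concentration of the quantum kernel -/

section Concentration

variable {Ω : Type*} [MeasurableSpace Ω] {P : Measure Ω} [IsProbabilityMeasure P] {n : ℕ}
  {V' : Ω → UGroup (Bits n)} {ρ : Matrix (Bits n) (Bits n) ℂ}

theorem pairKernel_concentration_of_isTDesign {V : Ω → UGroup (Bits n)} (hρ : IsDensity ρ)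
    (hV : Measurable V) (hV' : Measurable V') (h : IndepFun V V' P) {t : ℕ}
    (hd : IsTDesign P t V) :
    (1 ≤ t → ∫ ω, pairKernel ρ (V ω) (V' ω) ∂P = 1 / 2 ^ n) ∧
    (2 ≤ t →
      (IsPure ρ → variance (fun ω => pairKernel ρ (V ω) (V' ω)) P =
        (2 ^ n - 1) / (2 ^ (2 * n) * (2 ^ n + 1))) ∧
      variance (fun ω => pairKernel ρ (V ω) (V' ω)) P ≤
        (2 ^ n - 1) / (2 ^ (2 * n) * (2 ^ n + 1)) ∧
      variance (fun ω => pairKernel ρ (V ω) (V' ω)) P ≤ (1 / 4) ^ n ∧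
      ∀ δ : ℝ, 0 < δ →
        P.real {ω | δ ≤ |pairKernel ρ (V ω) (V' ω) - 1 / 2 ^ n|} ≤ (1 / 4) ^ n / δ ^ 2) := by
  have hmean : 1 ≤ t → ∫ ω, pairKernel ρ (V ω) (V' ω) ∂P = 1 / 2 ^ n := fun ht =>
    integral_pairKernel_of_isTDesign hρ hV hV' h (hd.mono ht)
  refine ⟨hmean, fun ht => ?_⟩
  have hk : MemLp (fun ω => pairKernel ρ (V ω) (V' ω)) 2 P := memLp_pairKernel hV hV'
  have hμ := hmean (by omega)
  have hvar := variance_eq_integral_sq_sub hk hμ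
  have hle : variance (fun ω => pairKernel ρ (V ω) (V' ω)) P ≤
      (2 ^ n - 1) / (2 ^ (2 * n) * (2 ^ n + 1)) := by
    rw [hvar, ← two_div_sub_sq]
    exact sub_le_sub_right (integral_pairKernel_sq_le_of_isTDesign hρ hV hV' h (hd.mono ht)) _
  have hle' := hle.trans (design_bound_le n)
  refine ⟨fun hp => ?_, hle, hle', fun δ hδ => real_abs_sub_ge_le_of_variance_le hk hμ hle' hδ⟩
  rw [hvar, ← two_div_sub_sq,
    integral_pairKernel_sq_of_isTDesign_of_isPure hρ hp hV hV' h (hd.mono ht)]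

theorem pairKernel_concentration_of_layers {m κ L : ℕ}
    {layout : Fin (L + 1) → (Fin κ × Fin m ≃ Fin n)}
    {W : Fin (L + 1) → Fin κ → Ω → UGroup (Bits m)} (hm : 1 ≤ m) (hn : n = m * κ)
    (hρ : IsDensity ρ) (hW : ∀ d k, Measurable (W d k)) (hV' : Measurable V')
    (hind : iIndepFun (fun (b : Fin (L + 1) × Fin κ) ω => W b.1 b.2 ω) P)
    (hindV' : IndepFun (fun ω (b : Fin (L + 1) × Fin κ) => W b.1 b.2 ω) V' P) {t : ℕ}
    (hd : ∀ k, IsTDesign P t (W (Fin.last L) k)) {K : Ω → ℝ}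
    (hK : ∀ ω, K ω = pairKernel ρ (layeredCircuit layout fun d k => W d k ω) (V' ω)) :
    (1 ≤ t → ∫ ω, K ω ∂P = 1 / 2 ^ n) ∧
    (2 ≤ t →
      variance K P ≤ 2 ^ κ / (2 ^ (2 * m) - 1) ^ κ - 1 / 2 ^ (2 * n) ∧
      variance K P ≤ (2 / 3) ^ n ∧
      ∀ δ : ℝ, 0 < δ → P.real {ω | δ ≤ |K ω - 1 / 2 ^ n|} ≤ (2 / 3) ^ n / δ ^ 2) := by
  obtain rfl : K = _ := funext hK
  have hmean : 1 ≤ t → ∫ ω, pairKernel ρ (layeredCircuit layout fun d k => W d k ω) (V' ω) ∂P =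
      1 / 2 ^ n := fun ht =>
    integral_pairKernel_layeredCircuit hW hV' hind hindV' hn hρ fun k => (hd k).mono ht
  refine ⟨hmean, fun ht => ?_⟩
  have hk : MemLp (fun ω => pairKernel ρ (layeredCircuit layout fun d k => W d k ω) (V' ω)) 2 P :=
    memLp_pairKernel_layeredCircuit hW hV'
  have hμ := hmean (by omega)
  have hle : variance (fun ω => pairKernel ρ (layeredCircuit layout fun d k => W d k ω) (V' ω)) P ≤
      2 ^ κ / (2 ^ (2 * m) - 1) ^ κ - 1 / 2 ^ (2 * n) := by
    rw [variance_eq_integral_sq_sub hk hμ, ← div_pow, one_div_pow, ← pow_mul, mul_comm n 2]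
    exact sub_le_sub_right (integral_pairKernel_layeredCircuit_sq_le hW hV' hind hindV' hm hρ
      fun k => (hd k).mono ht) _
  have hb := layer_bound_le m κ hm
  rw [← hn] at hb
  exact ⟨hle, hle.trans hb,
    fun δ hδ => real_abs_sub_ge_le_of_variance_le hk hμ (hle.trans hb) hδ⟩

end Concentration

end QKernel

theorem mainTheorem1
    {Ω : Type*} [MeasurableSpace Ω] (P : Measure Ω) [IsProbabilityMeasure P]
    {X Θ : Type*} (ξ ξ' : Ω → X) (ϑ : Ω → Θ) :
    -- Case (1): one of `U(x,θ)`, `U(x',θ)` is a `t`-design on all `n` qubits.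
    (∀ (n : ℕ) (ρ₀ : Matrix (QKernel.Bits n) (QKernel.Bits n) ℂ), QKernel.IsDensity ρ₀ →
      ∀ U : X → Θ → QKernel.UGroup (QKernel.Bits n),
        Measurable (fun ω => U (ξ ω) (ϑ ω)) → Measurable (fun ω => U (ξ' ω) (ϑ ω)) →
        IndepFun (fun ω => U (ξ ω) (ϑ ω)) (fun ω => U (ξ' ω) (ϑ ω)) P →
        ∀ t : ℕ,
          (QKernel.IsTDesign P t (fun ω => U (ξ ω) (ϑ ω)) ∨
            QKernel.IsTDesign P t (fun ω => U (ξ' ω) (ϑ ω))) →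
          (1 ≤ t →
            ∫ ω, QKernel.quantumKernel U ρ₀ (ϑ ω) (ξ ω) (ξ' ω) ∂P = 1 / 2 ^ n) ∧
          (2 ≤ t →
            (QKernel.IsPure ρ₀ →
              variance (fun ω => QKernel.quantumKernel U ρ₀ (ϑ ω) (ξ ω) (ξ' ω)) P =
                (2 ^ n - 1) / (2 ^ (2 * n) * (2 ^ n + 1))) ∧
            variance (fun ω => QKernel.quantumKernel U ρ₀ (ϑ ω) (ξ ω) (ξ' ω)) P ≤
              (2 ^ n - 1) / (2 ^ (2 * n) * (2 ^ n + 1)) ∧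
            variance (fun ω => QKernel.quantumKernel U ρ₀ (ϑ ω) (ξ ω) (ξ' ω)) P ≤
              (1 / 4) ^ n ∧
            ∀ δ : ℝ, 0 < δ →
              P.real {ω | δ ≤ |QKernel.quantumKernel U ρ₀ (ϑ ω) (ξ ω) (ξ' ω) - 1 / 2 ^ n|} ≤
                (1 / 4) ^ n / δ ^ 2)) ∧
    -- Case (2): layered circuits whose `m`-qubit blocks are independent `t`-designs, for every
    -- layout, in particular for the alternating layered ansatz (`QKernel.alternatingLayout`).
    (∀ (n m κ L : ℕ), 1 ≤ m → 1 ≤ κ → 1 ≤ L → n = m * κ →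
      ∀ ρ₀ : Matrix (QKernel.Bits n) (QKernel.Bits n) ℂ, QKernel.IsDensity ρ₀ →
      ∀ (layout : Fin L → (Fin κ × Fin m ≃ Fin n))
        (W : Fin L → Fin κ → X → Θ → QKernel.UGroup (QKernel.Bits m))
        (U : X → Θ → QKernel.UGroup (QKernel.Bits n)),
        (∀ x θ, U x θ = QKernel.layeredCircuit layout (fun d k => W d k x θ)) →
        (∀ d k, Measurable (fun ω => W d k (ξ ω) (ϑ ω))) →
        Measurable (fun ω => U (ξ' ω) (ϑ ω)) →
        iIndepFun (fun (b : Fin L × Fin κ) ω => W b.1 b.2 (ξ ω) (ϑ ω)) P →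
        IndepFun (fun ω (b : Fin L × Fin κ) => W b.1 b.2 (ξ ω) (ϑ ω))
          (fun ω => U (ξ' ω) (ϑ ω)) P →
        ∀ t : ℕ, (∀ d k, QKernel.IsTDesign P t (fun ω => W d k (ξ ω) (ϑ ω))) →
          (1 ≤ t →
            ∫ ω, QKernel.quantumKernel U ρ₀ (ϑ ω) (ξ ω) (ξ' ω) ∂P = 1 / 2 ^ n) ∧
          (2 ≤ t →
            variance (fun ω => QKernel.quantumKernel U ρ₀ (ϑ ω) (ξ ω) (ξ' ω)) P ≤
              2 ^ κ / (2 ^ (2 * m) - 1) ^ κ - 1 / 2 ^ (2 * n) ∧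
            variance (fun ω => QKernel.quantumKernel U ρ₀ (ϑ ω) (ξ ω) (ξ' ω)) P ≤
              (2 / 3) ^ n ∧
            ∀ δ : ℝ, 0 < δ →
              P.real {ω | δ ≤ |QKernel.quantumKernel U ρ₀ (ϑ ω) (ξ ω) (ξ' ω) - 1 / 2 ^ n|} ≤
                (2 / 3) ^ n / δ ^ 2)) ∧
    -- Size of the bound of case (2): its ratio to `2^{-n(2-1/m)}`, exactly and in the limit.
    (∀ (m κ : ℕ), 1 ≤ m → 1 ≤ κ →
      (2 : ℝ) ^ κ / (2 ^ (2 * m) - 1) ^ κ - 1 / 2 ^ (2 * (m * κ)) =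
        ((1 - 1 / 4 ^ m)⁻¹ ^ κ - 1 / 2 ^ κ) *
          (2 : ℝ) ^ (-((m * κ : ℕ) : ℝ) * (2 - 1 / (m : ℝ)))) ∧
    (∀ m κ : ℕ → ℕ, Tendsto κ atTop atTop →
      Tendsto (fun j => (κ j : ℝ) / 4 ^ m j) atTop (𝓝 0) →
      Tendsto (fun j =>
        ((2 : ℝ) ^ κ j / (2 ^ (2 * m j) - 1) ^ κ j - 1 / 2 ^ (2 * (m j * κ j))) /
        (2 : ℝ) ^ (-((m j * κ j : ℕ) : ℝ) * (2 - 1 / (m j : ℝ)))) atTop (𝓝 1)) := by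
  refine ⟨?_, ?_, fun m κ hm _ => QKernel.layer_bound_eq m κ hm,
    fun m κ => QKernel.tendsto_layer_bound_ratio m κ⟩
  · intro n ρ₀ hρ U hU hU' hind t hd
    simp only [QKernel.quantumKernel_eq_pairKernel]
    rcases hd with hd | hd
    · exact QKernel.pairKernel_concentration_of_isTDesign hρ hU hU' hind hd
    · simp only [QKernel.pairKernel_comm ρ₀ (U (ξ _) _)]
      exact QKernel.pairKernel_concentration_of_isTDesign hρ hU' hU hind.symm hd
  · intro n m κ L hm _ hL hn ρ₀ hρ layout W U hU hW hU' hind hind' t hd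
    obtain ⟨L, rfl⟩ : ∃ L', L = L' + 1 := ⟨L - 1, by omega⟩
    refine QKernel.pairKernel_concentration_of_layers (layout := layout)
      (W := fun d k ω => W d k (ξ ω) (ϑ ω)) hm hn hρ hW hU' hind hind' (fun k => hd _ k) fun ω => ?_
    rw [QKernel.quantumKernel_eq_pairKernel, hU (ξ ω)]
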